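/- Let $S$ be a polynomial ring in finitely many variables over an arbitrary field, and let $M\subseteq S$ be a monomial ideal with minimal generating set $G=\{l_1,\dots,l_q\}$ of (pairwise distinct) monomials. A monomial $m\in G$ is *dominant* (in $G$) if there are a variable $x$ and an integer $k>0$ such that $x^k\mid m$ and $x^k\nmid m'$ for all $m'\in G\setminus\{m\}$. Assume that $M$ is *2-semidominant*, i.e. exactly two elements of $G$ are not dominant. Let $\mathbb T_M$ be the Taylor resolution of $S/M$: its basis in homological degree $j$ consists of the symbols $[\sigma]=[l_{r_1},\dots,l_{r_j}]$, $r_1<\dots<r_j$, of multidegree $\operatorname{mdeg}[\sigma]=\operatorname{lcm}(l_{r_1},\dots,l_{r_j})$ (with $[\varnothing]$ of multidegree $1$ in degree $0$), and $$f_j[\sigma]=\sum_{i=1}^j(-1)^{i+1}\frac{\operatorname{mdeg}[\sigma]}{\operatorname{mdeg}[\sigma\setminus\{l_{r_i}\}]}\,[\sigma\setminus\{l_{r_i}\}].$$ The element $[\tau]$ is a *facet* of $[\sigma]$ if $\tau$ is obtained from $\sigma$ by deleting one generator. Let $\mathbb F$ be a multigraded complex of free modules with chosen bases, and let $[\sigma]$,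 $[\tau]$ be basis elements in homological degrees $j+1$ and $j$ such that the coefficient $a_{\tau\sigma}$ of $[\tau]$ in $f_{j+1}[\sigma]$ is invertible. The *standard change of basis* around $a_{\tau\sigma}$ replaces $[\tau]$ by $[\tau]'=\sum_{\pi}a_{\pi\sigma}[\pi]$ (the sum is over the basis elements in degree $j$), replaces each basis element $[\theta]\ne[\sigma]$ in degree $j+1$ by $[\theta]'=[\theta]-\frac{a_{\tau\theta}}{a_{\tau\sigma}}[\sigma]$, and keeps all the others; the names and multidegrees of the basis elements are kept. The *standard cancellation* $0\to S[\sigma]\to S[\tau]\to0$ consists of this change of basis followed by the removal of $[\sigma]$ and $[\tau]$. Let $A=\{([\sigma_1],[\tau_1]),\dots,([\sigma_k],[\tau_k])\}$ be a family of pairs of basis elements of $\mathbb T_M$ such that 1. for $i\neq j$ the pairs are disjoint: $[\sigma_i]\ne[\sigma_j],[\tau_j]$ and $[\tau_i]\neq[\sigma_j],[\tau_j]$; 2. $[\tau_i]$ is a facet of $[\sigma_i]$ for all $i$; 3. $\operatorname{mdeg}[\sigma_i]=\operatorname{mdeg}[\tau_i]$ for all $i$; 4. $A$ is maximal with respect to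 inclusion among the families satisfying 1, 2 and 3. Then, starting with $\mathbb T_M$, all the standard cancellations $0\to S[\sigma]\to S[\tau]\to0$ with $([\sigma],[\tau])\in A$ can be made one after the other, in any order (each corresponding entry being invertible when its turn comes), and for every order the result $\mathbb F$ is a minimal multigraded free resolution of $S/M$, with $$\mathbb T_M\cong\mathbb F\oplus\Bigl(\bigoplus_{([\sigma],[\tau])\in A}0\to S[\sigma]\to S[\tau]\to0\Bigr)$$ as multigraded complexes over $S/M$, where $[\sigma]\mapsto[\tau]$ in each summand, and $[\sigma]$, $[\tau]$ keep their homological degrees and multidegrees. -/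

import Mathlib

/-! Monomials of `S = k[x_v : v ∈ ι]` are represented by their exponent vectors `ι →₀ ℕ`:
divisibility is `≤` and the least common multiple is `⊔`. -/

section Dominance

variable {ι : Type*}

/-- `m ∈ G` has a dominant variable `x` with respect to `G`: for some `k > 0`, `x ^ k` divides `m`
and divides no other element of `G`. -/
def IsDominantMonomial (G : Set (ι →₀ ℕ)) (m : ι →₀ ℕ) : Prop :=
  ∃ x : ι, ∃ k : ℕ, 0 < k ∧ k ≤ m x ∧ ∀ m' ∈ G, m' ≠ m → ¬ k ≤ m' x

/-- A set of monomials is `p`-semidominant if exactly `p` of its elements are not dominant. -/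
def IsSemidominantSet (p : ℕ) (G : Set (ι →₀ ℕ)) : Prop :=
  {m | m ∈ G ∧ ¬ IsDominantMonomial G m}.encard = p

/-- The list `l 0, …, l (q-1)` of pairwise distinct monomials is the minimal generating set
of the ideal `M`. -/
def IsMinimalMonomialGenerators {k : Type*} [Field k] {q : ℕ} (l : Fin q → ι →₀ ℕ)
    (M : Ideal (MvPolynomial ι k)) : Prop :=
  Function.Injective l ∧
    Minimal (fun G : Set (ι →₀ ℕ) =>
      Ideal.span ((fun a => MvPolynomial.monomial a (1 : k)) '' G) = M) (Set.range l)

/-- Multidegree of the basis element `[σ]`: the least common multiple of the monomials in `σ`. -/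
noncomputable def faceMdeg {q : ℕ} (l : Fin q → ι →₀ ℕ) (σ : Finset (Fin q)) : ι →₀ ℕ :=
  σ.sup l

/-- `[τ]` is a facet of `[σ]`: it is obtained by deleting one vertex. -/
def IsFacetOf {q : ℕ} (τ σ : Finset (Fin q)) : Prop :=
  ∃ i ∈ σ, τ = σ.erase i

/-- A family of pairwise disjoint pairs `([σ], [τ])` such that `[τ]` is a facet of `[σ]` and
both have the same multidegree. -/
def IsFaceFacetFamily {q : ℕ} (l : Fin q → ι →₀ ℕ)
    (A : Finset (Finset (Fin q) × Finset (Fin q))) : Prop :=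
  (∀ p ∈ A, ∀ p' ∈ A, p ≠ p' → p.1 ≠ p'.1 ∧ p.1 ≠ p'.2 ∧ p.2 ≠ p'.1 ∧ p.2 ≠ p'.2) ∧
  (∀ p ∈ A, IsFacetOf p.2 p.1) ∧
  (∀ p ∈ A, faceMdeg l p.1 = faceMdeg l p.2)

end Dominance

/-- Data of a sequence `⋯ → F_2 → F_1 → F_0 → S/M` of free `S`-modules with fixed bases, where the
basis of `F_j` consists of the symbols `[σ]`, `σ ∈ basis`, `σ.card = j`.  The coefficient of `[τ]`
in the image of `[σ]` is `mat τ σ`, and `aug σ` is the image in `S/M` of a basis element of `F_0`.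
Neither exactness nor `d ∘ d = 0` is part of the data; see `IsGradedFreeResolution`. -/
@[ext]
structure FramedComplex {ι k : Type*} [Field k] (q : ℕ) (M : Ideal (MvPolynomial ι k)) where
  basis : Finset (Finset (Fin q))
  mat : Matrix (Finset (Fin q)) (Finset (Fin q)) (MvPolynomial ι k)
  aug : Finset (Fin q) → MvPolynomial ι k ⧸ M
  mat_eq_zero : ∀ τ σ, ¬ (τ ∈ basis ∧ σ ∈ basis ∧ σ.card = τ.card + 1) → mat τ σ = 0
  aug_eq_zero : ∀ σ, ¬ (σ ∈ basis ∧ σ.card = 0) → aug σ = 0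

namespace FramedComplex

variable {ι k : Type*} [Field k] {q : ℕ} {M : Ideal (MvPolynomial ι k)}

/-- The free module `F_j` in homological degree `j`, in coordinates. -/
abbrev X (F : FramedComplex q M) (j : ℕ) : Type _ :=
  {σ : Finset (Fin q) // σ ∈ F.basis ∧ σ.card = j} → MvPolynomial ι k

/-- The differential `F_{j+1} → F_j`. -/
noncomputable def d (F : FramedComplex q M) (j : ℕ) : F.X (j + 1) →ₗ[MvPolynomial ι k] F.X j :=
  Matrix.mulVecLin (F.mat.submatrix Subtype.val Subtype.val)

/-- The augmentation `F_0 → S/M`. -/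
noncomputable def augmentation (F : FramedComplex q M) :
    F.X 0 →ₗ[MvPolynomial ι k] (MvPolynomial ι k ⧸ M) :=
  Fintype.linearCombination (MvPolynomial ι k) (fun σ => F.aug σ.1)

/-- `x ∈ F_j` is homogeneous of multidegree `m`, where `[σ]` has multidegree `faceMdeg l σ`. -/
def IsHomogeneousElt (F : FramedComplex q M) (l : Fin q → ι →₀ ℕ) {j : ℕ} (m : ι →₀ ℕ)
    (x : F.X j) : Prop :=
  ∀ σ, ∀ e ∈ (x σ).support, e + faceMdeg l σ.1 = m

/-- `F` is a multigraded free resolution of `S/M`: the sequence `⋯ → F_1 → F_0 → S/M → 0` is exact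
and its maps preserve multidegrees. -/
structure IsGradedFreeResolution (F : FramedComplex q M) (l : Fin q → ι →₀ ℕ) : Prop where
  surjective : Function.Surjective F.augmentation
  exact_zero : Function.Exact (F.d 0) F.augmentation
  exact_succ : ∀ j, Function.Exact (F.d (j + 1)) (F.d j)
  homogeneous : ∀ τ σ, ∀ e ∈ (F.mat τ σ).support, e + faceMdeg l τ = faceMdeg l σ
  homogeneous_aug : ∀ σ, ∃ c : k,
    F.aug σ = Ideal.Quotient.mk M (MvPolynomial.monomial (faceMdeg l σ) c)

/-- Minimality: the image of every differential `F_{j+1} → F_j` is contained in `𝔪 F_j`, where `𝔪`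
is the ideal generated by the variables. -/
def IsMinimal (F : FramedComplex q M) : Prop :=
  ∀ j, LinearMap.range (F.d j) ≤
    (Ideal.span (Set.range (MvPolynomial.X : ι → MvPolynomial ι k))) •
      (⊤ : Submodule (MvPolynomial ι k) (F.X j))

/-- The Taylor resolution on the list of monomials `l`: its basis is the full simplex (including
the empty face), the coefficient of `[σ \ {i}]` in the image of `[σ]` is
`± mdeg [σ] / mdeg [σ \ {i}]`, with sign `+` if `i` is the first vertex of `σ`, `-` if it is the
second one, and so on, and `[∅]` is mapped to `1`. -/
noncomputable def taylor (M : Ideal (MvPolynomial ι k)) (l : Fin q → ι →₀ ℕ) :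
    FramedComplex q M where
  basis := Finset.univ
  mat τ σ := ∑ i ∈ σ, if τ = σ.erase i then
    MvPolynomial.monomial (faceMdeg l σ - faceMdeg l τ)
      ((-1 : k) ^ (σ.filter (fun i' => i' < i)).card) else 0
  aug σ := if σ = ∅ then 1 else 0
  mat_eq_zero τ σ h := by
    refine Finset.sum_eq_zero fun i hi => if_neg ?_
    rintro rfl
    exact h ⟨Finset.mem_univ _, Finset.mem_univ _, (Finset.card_erase_add_one hi).symm⟩
  aug_eq_zero σ h := by
    refine if_neg ?_
    rintro rfl
    exact h ⟨Finset.mem_univ _, Finset.card_empty⟩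

/-- The standard change of basis around the entry `a_{τσ} = F.mat τ σ`: the column with index `θ` is
the new basis element `[θ]'`, written in the old basis.  It is `∑_π a_{πσ} [π]` for `θ = τ`;
it is `[θ] - (a_{τθ} / a_{τσ}) [σ]` for `θ ≠ σ` in the homological degree of `σ`; all other basis
elements are kept. -/
noncomputable def changeOfBasis (F : FramedComplex q M) (σ τ : Finset (Fin q)) :
    Matrix (Finset (Fin q)) (Finset (Fin q)) (MvPolynomial ι k) :=
  Matrix.of fun π θ =>
    if θ = τ then F.mat π σ
    else if θ ≠ σ ∧ θ.card = σ.card then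
      (if π = θ then 1 else 0)
        - (if π = σ then F.mat τ θ * Ring.inverse (F.mat τ σ) else 0)
    else if π = θ then 1 else 0

/-- The result of the standard cancellation `0 → S[σ] → S[τ] → 0`: the maps are written in the bases
given by the standard change of basis around `a_{τσ}`, and `[σ]`, `[τ]` are removed. -/
noncomputable def cancel (F : FramedComplex q M) (σ τ : Finset (Fin q)) :
    FramedComplex q M where
  basis := F.basis \ {σ, τ}
  mat π θ :=
    if π ∈ F.basis \ {σ, τ} ∧ θ ∈ F.basis \ {σ, τ} ∧ θ.card = π.card + 1 then
      ((F.changeOfBasis σ τ)⁻¹ * F.mat * F.changeOfBasis σ τ) π θ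
    else 0
  aug θ :=
    if θ ∈ F.basis \ {σ, τ} ∧ θ.card = 0 then ∑ π, F.changeOfBasis σ τ π θ • F.aug π else 0
  mat_eq_zero _ _ h := if_neg h
  aug_eq_zero _ h := if_neg h

/-- The standard cancellation `0 → S[σ] → S[τ] → 0` can be made in `F`: `[σ]` and `[τ]` are basis
elements in consecutive homological degrees that determine an invertible entry. -/
def CanCancel (F : FramedComplex q M) (σ τ : Finset (Fin q)) : Prop :=
  σ ∈ F.basis ∧ τ ∈ F.basis ∧ σ.card = τ.card + 1 ∧ IsUnit (F.mat τ σ)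

/-- `F'` is obtained from `F` by making the standard cancellations `0 → S[σ] → S[τ] → 0` given by
the pairs `(σ, τ)` of the list, in this order, each of them being possible when its turn comes. -/
inductive CancelSeq : FramedComplex q M → List (Finset (Fin q) × Finset (Fin q)) →
    FramedComplex q M → Prop
  | nil (F : FramedComplex q M) : CancelSeq F [] F
  | cons (F F' : FramedComplex q M) (σ τ : Finset (Fin q))
      (L : List (Finset (Fin q) × Finset (Fin q)))
      (h : F.CanCancel σ τ) (h' : CancelSeq (F.cancel σ τ) L F') : CancelSeq F ((σ, τ) :: L) F'

/-- The complex `0 → S[σ] → S[τ] → 0`, `[σ] ↦ [τ]`, for `p = (σ, τ)`, with `[σ]` and `[τ]` in the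
homological degrees `σ.card` and `τ.card`. -/
noncomputable def short (M : Ideal (MvPolynomial ι k))
    (p : Finset (Fin q) × Finset (Fin q)) : FramedComplex q M where
  basis := {p.1, p.2}
  mat π θ := if π = p.2 ∧ θ = p.1 ∧ θ.card = π.card + 1 then 1 else 0
  aug _ := 0
  mat_eq_zero π θ h := by
    refine if_neg ?_
    rintro ⟨rfl, rfl, hc⟩
    exact h ⟨by simp, by simp, hc⟩
  aug_eq_zero _ _ := rfl

/-- `T = F ⊕ (⨁_{(σ, τ) ∈ A} 0 → S[σ] → S[τ] → 0)`: an isomorphism of complexes over `S/M` that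
preserves multidegrees. -/
def IsDirectSumWith (T F : FramedComplex q M) (l : Fin q → ι →₀ ℕ)
    (A : Finset (Finset (Fin q) × Finset (Fin q))) : Prop :=
  ∃ e : ∀ j, T.X j ≃ₗ[MvPolynomial ι k] (F.X j × (∀ p : A, (short M p.1).X j)),
    (∀ j (x : T.X (j + 1)),
      e j (T.d j x) =
        (F.d j (e (j + 1) x).1, fun p => (short M p.1).d j ((e (j + 1) x).2 p))) ∧
    (∀ x : T.X 0, F.augmentation (e 0 x).1 = T.augmentation x) ∧
    (∀ j (m : ι →₀ ℕ) (x : T.X j), T.IsHomogeneousElt l m x →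
      F.IsHomogeneousElt l m (e j x).1 ∧
        ∀ p : A, (short M p.1).IsHomogeneousElt l m ((e j x).2 p))

end FramedComplex

/-! Cancelling around an invertible entry $a_{\tau\sigma}$ is a Schur complement step: every
surviving entry becomes $a_{\pi\theta}-a_{\pi\sigma}a_{\tau\sigma}^{-1}a_{\tau\theta}$, and $0\to
S[\sigma]\to S[\tau]\to0$ splits off (`CanCancel.cancel_mat`, `CanCancel.splitsOff`). Exactness
passes to the remaining summand, so what must be shown is that all pairs of $A$ stay cancellable and
that the end result is minimal.

Both follow from one consequence of 2-semidominance. The multidegree of a face determines its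
dominant vertices, so two faces of equal multidegree differ only in the two nondominant vertices; if
their sizes are consecutive, one is a facet of the other (`IsSemidominantSet.isFacetOf`).

Order: cancelling $(\sigma,\tau)$ changes the entry of another pair $(\sigma',\tau')$ only if
$a_{\tau'\sigma}$ and $a_{\tau\sigma'}$ are both nonzero. By homogeneity all four multidegrees then
agree, and $\sigma,\sigma'$ have the same size. So $\tau,\tau'$ are distinct facets of both $\sigma$
and $\sigma'$, which forces $\sigma=\sigma'$, against disjointness (`exists_cancelSeq`,
`eq_of_isFacetOf`).

Minimality: if two surviving faces of consecutive sizes had equal multidegree, they would be a face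
and a facet and could be added to $A$. Hence each nonzero surviving entry joins different
multidegrees and lies in the irrelevant ideal.

Exactness of the Taylor resolution is proved strand by strand, by a simplicial cone. -/

open Finset

/-! ### Homogeneous matrix entries -/

/-- `p` is homogeneous as an entry going from multidegree `b` to multidegree `a`. -/
def IsHomogeneousEntry {ι k : Type*} [Field k] (a b : ι →₀ ℕ) (p : MvPolynomial ι k) : Prop :=
  ∀ e ∈ p.support, e + a = b

namespace IsHomogeneousEntry

variable {ι k : Type*} [Field k] {a b c : ι →₀ ℕ} {p p' : MvPolynomial ι k}

lemma zero : IsHomogeneousEntry a b (0 : MvPolynomial ι k) := by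
  intro e he; simp at he

lemma add (hp : IsHomogeneousEntry a b p) (hp' : IsHomogeneousEntry a b p') :
    IsHomogeneousEntry a b (p + p') := by
  classical
  intro e he
  rcases mem_union.1 (MvPolynomial.support_add he) with h | h
  exacts [hp e h, hp' e h]

lemma neg (hp : IsHomogeneousEntry a b p) : IsHomogeneousEntry a b (-p) := by
  intro e he
  rw [MvPolynomial.support_neg] at he
  exact hp e he

lemma sub (hp : IsHomogeneousEntry a b p) (hp' : IsHomogeneousEntry a b p') :
    IsHomogeneousEntry a b (p - p') := by
  rw [sub_eq_add_neg]; exact hp.add hp'.neg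

lemma mul (hp : IsHomogeneousEntry a b p) (hp' : IsHomogeneousEntry b c p') :
    IsHomogeneousEntry a c (p * p') := by
  classical
  intro e he
  obtain ⟨e₁, h₁, e₂, h₂, rfl⟩ := mem_add.1 (MvPolynomial.support_mul _ _ he)
  rw [← hp' e₂ h₂, ← hp e₁ h₁]
  abel

lemma sum {α : Type*} (s : Finset α) (f : α → MvPolynomial ι k)
    (h : ∀ i ∈ s, IsHomogeneousEntry a b (f i)) : IsHomogeneousEntry a b (∑ i ∈ s, f i) := by
  classical
  induction s using Finset.induction_on with
  | empty => simpa using zero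
  | insert i s hi ih =>
    rw [sum_insert hi]
    exact (h i (mem_insert_self _ _)).add (ih fun j hj => h j (mem_insert_of_mem hj))

lemma monomial (e : ι →₀ ℕ) (r : k) (h : e + a = b) :
    IsHomogeneousEntry a b (MvPolynomial.monomial e r) := by
  intro e' he'
  have := MvPolynomial.support_monomial_subset he'
  rw [mem_singleton] at this
  rw [this, h]

lemma eq_zero_or_le (hp : IsHomogeneousEntry a b p) : p = 0 ∨ a ≤ b := by
  rw [or_iff_not_imp_left]
  intro h
  obtain ⟨e, he⟩ := MvPolynomial.support_nonempty.2 h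
  exact (hp e he) ▸ le_add_self

/-- Units of a polynomial ring over a field are nonzero constants, so the exponent $0$ occurs in
`p`. -/
lemma eq_of_isUnit (hp : IsHomogeneousEntry a b p) (hu : IsUnit p) : a = b := by
  obtain ⟨r, hr, rfl⟩ := MvPolynomial.isUnit_iff_eq_C_of_isReduced.1 hu
  have := hp 0 (by simp [MvPolynomial.mem_support_iff, hr.ne_zero])
  simpa using this

lemma inverse (hp : IsHomogeneousEntry a b p) (hu : IsUnit p) :
    IsHomogeneousEntry b a (Ring.inverse p) := by
  have hab := hp.eq_of_isUnit hu
  obtain ⟨r, hr, h⟩ := MvPolynomial.isUnit_iff_eq_C_of_isReduced.1 hu.ringInverse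
  rw [h, MvPolynomial.C_apply]
  exact monomial _ _ (by simp [hab])

/-- A homogeneous entry between different multidegrees lies in the irrelevant ideal. -/
lemma mem_span_X (hp : IsHomogeneousEntry a b p) (hab : a ≠ b) :
    p ∈ Ideal.span (Set.range (MvPolynomial.X : ι → MvPolynomial ι k)) := by
  rw [← Set.image_univ, MvPolynomial.mem_ideal_span_X_image]
  intro e he
  by_contra! h
  have : e = 0 := by ext i; exact h i trivial
  exact hab (by simpa [this] using hp e he)

end IsHomogeneousEntry

/-! ### Boundary and cone on the full simplex -/

/-- The boundary of a chain on the full simplex. -/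
def simplexBoundary {R : Type*} [CommRing R] {q : ℕ} (c : Finset (Fin q) → R)
    (τ : Finset (Fin q)) : R :=
  ∑ i, if i ∈ τ then 0 else (-1) ^ #{i' ∈ τ | i' < i} * c (insert i τ)

/-- The cone operator with apex `i₀`. -/
def simplexCone {R : Type*} [CommRing R] {q : ℕ} (i₀ : Fin q) (c : Finset (Fin q) → R)
    (σ : Finset (Fin q)) : R :=
  if i₀ ∈ σ then c (σ.erase i₀) else 0

/-- Adding two vertices in either order gives the same face with opposite signs; the involution
swaps the order. -/
lemma simplexBoundary_boundary {R : Type*} [CommRing R] {q : ℕ} (c : Finset (Fin q) → R) :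
    simplexBoundary (simplexBoundary c) = 0 := by
  funext τ
  simp only [simplexBoundary, mul_sum, Pi.zero_apply]
  have : ∀ i : Fin q, (if i ∈ τ then 0 else ∑ i', (-1) ^ #{j ∈ τ | j < i} *
      (if i' ∈ insert i τ then 0 else
        (-1) ^ #{j ∈ insert i τ | j < i'} * c (insert i' (insert i τ)))) =
      ∑ i', if i ∈ τ ∨ i' ∈ insert i τ then 0 else (-1) ^ #{j ∈ τ | j < i} *
        ((-1) ^ #{j ∈ insert i τ | j < i'} * c (insert i' (insert i τ))) := by
    intro i
    split_ifs with h
    · simp [h]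
    · exact sum_congr rfl fun i' _ => by simp [h]
  simp only [this]
  rw [← Fintype.sum_prod_type']
  refine sum_involution (fun p _ => (p.2, p.1)) ?_ ?_ (fun _ _ => mem_univ _) (fun _ _ => rfl)
  · rintro ⟨i, i'⟩ -
    have key : ∀ a b : Fin q, a ∉ τ → b ∉ τ → a < b →
        (-1 : R) ^ #{j ∈ insert a τ | j < b} = - (-1) ^ #{j ∈ τ | j < b} ∧
        (-1 : R) ^ #{j ∈ insert b τ | j < a} = (-1) ^ #{j ∈ τ | j < a} := by
      intro a b ha hb hab
      constructor
      · rw [filter_insert, if_pos hab, card_insert_of_notMem (by simp [ha]), pow_succ]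
        ring
      · rw [filter_insert, if_neg hab.not_gt]
    by_cases hi : i ∈ τ
    · simp [hi]
    by_cases hi' : i' ∈ τ
    · simp [hi']
    rcases lt_trichotomy i i' with h | h | h
    · have := key i i' hi hi' h
      simp only [mem_insert, hi, hi', h.ne, h.ne', or_self, if_false, this.1, this.2,
        Finset.insert_comm i' i τ]
      ring
    · simp [h]
    · have := key i' i hi' hi h
      simp only [mem_insert, hi, hi', h.ne, h.ne', or_self, if_false, this.1, this.2,
        Finset.insert_comm i' i τ]
      ring
  · rintro ⟨i, i'⟩ - h
    contrapose! h
    have : i' = i := (Prod.mk.inj h).1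
    simp [this]

/-- Coning from the first vertex of `V` is a contracting homotopy on the chains supported in `V`. -/
lemma simplexBoundary_cone_add {R : Type*} [CommRing R] {q : ℕ} (i₀ : Fin q)
    (c : Finset (Fin q) → R) (hc : ∀ σ, c σ ≠ 0 → ∀ i ∈ σ, i₀ ≤ i) (τ : Finset (Fin q)) :
    simplexBoundary (simplexCone i₀ c) τ + simplexCone i₀ (simplexBoundary c) τ = c τ := by
  -- On the support of `c` no vertex precedes the apex, so adding the apex carries the sign $+1$.
  have hsign : ∀ σ : Finset (Fin q), c (insert i₀ σ) ≠ 0 ∨ c σ ≠ 0 →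
      #{i' ∈ σ | i' < i₀} = 0 := by
    intro σ h
    rw [card_eq_zero, filter_eq_empty_iff]
    intro i hi
    rcases h with h | h
    · exact (hc _ h i (mem_insert_of_mem hi)).not_gt
    · exact (hc _ h i hi).not_gt
  by_cases h0 : i₀ ∈ τ
  · have e1 : simplexCone i₀ (simplexBoundary c) τ = simplexBoundary c (τ.erase i₀) := if_pos h0
    rw [e1, simplexBoundary, simplexBoundary, ← sum_add_distrib, sum_eq_single i₀]
    · rw [if_pos h0, if_neg (notMem_erase _ _), insert_erase h0, zero_add]
      by_cases hcτ : c τ = 0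
      · simp [hcτ]
      · rw [hsign _ (Or.inl (by rwa [insert_erase h0]))]
        simp
    · intro i _ hi
      by_cases hiτ : i ∈ τ
      · simp [hiτ, hi]
      · rw [if_neg hiτ, if_neg (by simp [hiτ]), simplexCone, if_pos (mem_insert_of_mem h0),
          erase_insert_of_ne hi]
        by_cases hz : c (insert i (τ.erase i₀)) = 0
        · simp [hz]
        · have hlt : i₀ < i := lt_of_le_of_ne (hc _ hz i (mem_insert_self _ _)) hi.symm
          have : #{j ∈ τ | j < i} = #{j ∈ τ.erase i₀ | j < i} + 1 := by
            rw [← card_erase_add_one (s := {j ∈ τ | j < i}) (a := i₀) (by simp [h0, hlt])]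
            congr 2
            ext j; simp; tauto
          rw [this, pow_succ]; ring
    · simp
  · have e1 : simplexCone i₀ (simplexBoundary c) τ = 0 := if_neg h0
    rw [e1, add_zero, simplexBoundary, sum_eq_single i₀]
    · rw [if_neg h0, simplexCone, if_pos (mem_insert_self _ _), erase_insert h0]
      by_cases hz : c τ = 0
      · simp [hz]
      · rw [hsign _ (Or.inr hz)]; simp
    · intro i _ hi
      have : i₀ ∉ insert i τ := by simp [h0, hi.symm]
      simp [simplexCone, this]
    · simp

/-! ### Coordinates extended by zero to all faces -/

namespace FramedComplex

variable {ι k : Type*} [Field k] {q : ℕ} {M : Ideal (MvPolynomial ι k)}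

/-- Extension by zero of the coordinates of an element of `F_j`. -/
noncomputable def ext0 (F : FramedComplex q M) {j : ℕ} (x : F.X j) (σ : Finset (Fin q)) : MvPolynomial ι k :=
  if h : σ ∈ F.basis ∧ σ.card = j then x ⟨σ, h⟩ else 0

section ext0

variable (F : FramedComplex q M) {j : ℕ}

lemma ext0_coe (x : F.X j) (σ : {σ : Finset (Fin q) // σ ∈ F.basis ∧ σ.card = j}) :
    F.ext0 x σ.1 = x σ := dif_pos σ.2

lemma ext0_of_not (x : F.X j) {σ : Finset (Fin q)} (h : ¬ (σ ∈ F.basis ∧ σ.card = j)) :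
    F.ext0 x σ = 0 := dif_neg h

lemma ext0_add (x y : F.X j) : F.ext0 (x + y) = F.ext0 x + F.ext0 y := by
  funext σ
  simp only [ext0, Pi.add_apply]
  split_ifs <;> simp

lemma ext0_smul (r : MvPolynomial ι k) (x : F.X j) : F.ext0 (r • x) = r • F.ext0 x := by
  funext σ
  simp only [ext0, Pi.smul_apply]
  split_ifs <;> simp

lemma ext0_zero : F.ext0 (0 : F.X j) = 0 := by
  funext σ
  simp [ext0]

lemma ext0_injective : Function.Injective (F.ext0 (j := j)) := by
  intro x y h
  funext σ
  rw [← F.ext0_coe x, ← F.ext0_coe y, h]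

lemma ext0_eq_of_support (f : Finset (Fin q) → MvPolynomial ι k)
    (hf : ∀ σ, ¬ (σ ∈ F.basis ∧ σ.card = j) → f σ = 0) :
    F.ext0 (j := j) (fun σ => f σ.1) = f := by
  funext σ
  by_cases h : σ ∈ F.basis ∧ σ.card = j
  · exact dif_pos h
  · rw [ext0_of_not _ _ h, hf σ h]

lemma sum_subtype_eq {N : Type*} [AddCommMonoid N] (f : Finset (Fin q) → N)
    (hf : ∀ σ, ¬ (σ ∈ F.basis ∧ σ.card = j) → f σ = 0) :
    ∑ σ : {σ : Finset (Fin q) // σ ∈ F.basis ∧ σ.card = j}, f σ.1 = ∑ σ, f σ :=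
  Fintype.sum_of_injective Subtype.val Subtype.val_injective _ _
    (fun σ h => hf σ (by simpa using h)) fun _ => rfl

lemma d_apply (x : F.X (j + 1)) (τ : {σ : Finset (Fin q) // σ ∈ F.basis ∧ σ.card = j}) :
    F.d j x τ = (F.mat.mulVec (F.ext0 x)) τ.1 := by
  have := F.sum_subtype_eq (j := j + 1) (fun σ => F.mat τ.1 σ * F.ext0 x σ)
    (fun σ h => by rw [ext0_of_not _ _ h, mul_zero])
  rw [Matrix.mulVec, dotProduct, ← this]
  simp only [ext0_coe]
  rfl

lemma ext0_d (x : F.X (j + 1)) : F.ext0 (F.d j x) = F.mat.mulVec (F.ext0 x) := by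
  have : F.d j x = fun τ => (F.mat.mulVec (F.ext0 x)) τ.1 := funext fun τ => F.d_apply x τ
  rw [this]
  refine F.ext0_eq_of_support _ fun τ h => ?_
  rw [Matrix.mulVec, dotProduct]
  refine sum_eq_zero fun σ _ => ?_
  by_cases hσ : σ ∈ F.basis ∧ σ.card = j + 1
  · rw [F.mat_eq_zero, zero_mul]
    rintro ⟨h1, -, h3⟩
    exact h ⟨h1, by omega⟩
  · rw [ext0_of_not _ _ hσ, mul_zero]

lemma augmentation_apply (x : F.X 0) : F.augmentation x = ∑ σ, F.ext0 x σ • F.aug σ := by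
  rw [← F.sum_subtype_eq (j := 0)]
  · simp only [ext0_coe]
    rfl
  · intro σ h
    rw [ext0_of_not _ _ h, zero_smul]

lemma IsHomogeneousElt.ext0 {F : FramedComplex q M} {l : Fin q → ι →₀ ℕ} {m : ι →₀ ℕ} {x : F.X j}
    (hx : F.IsHomogeneousElt l m x) (σ : Finset (Fin q)) :
    IsHomogeneousEntry (faceMdeg l σ) m (F.ext0 x σ) := by
  by_cases h : σ ∈ F.basis ∧ σ.card = j
  · rw [F.ext0_coe x ⟨σ, h⟩]; exact hx ⟨σ, h⟩
  · rw [F.ext0_of_not _ h]; exact IsHomogeneousEntry.zero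

end ext0

/-! ### Matrices and augmentation after one cancellation -/

/-- Consecutive maps of `F`, including the augmentation, compose to zero. -/
structure IsComplex (F : FramedComplex q M) : Prop where
  mat_mul_mat : F.mat * F.mat = 0
  mat_aug : ∀ θ, ∑ π, F.mat π θ • F.aug π = 0

lemma IsComplex.mulVec_col {F : FramedComplex q M} (hF : F.IsComplex) (σ : Finset (Fin q)) :
    F.mat.mulVec (fun π => F.mat π σ) = 0 := by
  funext π
  exact congrFun (congrFun hF.mat_mul_mat π) σ

/-- All entries of the differentials of `F` are homogeneous. -/
def IsHomogeneousMat (F : FramedComplex q M) (l : Fin q → ι →₀ ℕ) : Prop :=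
  ∀ τ σ, IsHomogeneousEntry (faceMdeg l τ) (faceMdeg l σ) (F.mat τ σ)

section cancel

variable {F : FramedComplex q M} {σ τ : Finset (Fin q)}

lemma CanCancel.ne (h : F.CanCancel σ τ) : σ ≠ τ := by
  rintro rfl
  have := h.2.2.1
  omega

lemma mat_eq_zero_of_card (F : FramedComplex q M) {τ σ : Finset (Fin q)}
    (h : σ.card ≠ τ.card + 1) : F.mat τ σ = 0 :=
  F.mat_eq_zero _ _ fun h' => h h'.2.2

lemma mat_self (F : FramedComplex q M) (σ : Finset (Fin q)) : F.mat σ σ = 0 :=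
  F.mat_eq_zero_of_card (by omega)

lemma CanCancel.mul_inverse (h : F.CanCancel σ τ) :
    F.mat τ σ * Ring.inverse (F.mat τ σ) = 1 := Ring.mul_inverse_cancel _ h.2.2.2

/-- The degree condition on $\theta$ can be dropped: outside the degree of $\sigma$ the entry
$a_{\tau\theta}$ is already zero. -/
lemma changeOfBasis_apply (F : FramedComplex q M) (σ τ π θ : Finset (Fin q))
    (hc : σ.card = τ.card + 1) :
    F.changeOfBasis σ τ π θ =
      if θ = τ then F.mat π σ
      else (if π = θ then 1 else 0) -
        if π = σ ∧ θ ≠ σ then F.mat τ θ * Ring.inverse (F.mat τ σ) else 0 := by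
  simp only [changeOfBasis, Matrix.of_apply]
  by_cases h1 : θ = τ
  · simp [h1]
  by_cases h2 : θ = σ
  · simp [h2]
  by_cases h3 : θ.card = σ.card
  · simp [h1, h2, h3]
  · have : F.mat τ θ = 0 := F.mat_eq_zero_of_card (by omega)
    simp [h1, h2, h3, this]

/-- The inverse of the standard change of basis. -/
noncomputable def changeOfBasisInv (F : FramedComplex q M) (σ τ : Finset (Fin q)) :
    Matrix (Finset (Fin q)) (Finset (Fin q)) (MvPolynomial ι k) :=
  Matrix.of fun π θ =>
    if π = τ then (if θ = τ then Ring.inverse (F.mat τ σ) else 0)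
    else if π = σ then Ring.inverse (F.mat τ σ) * F.mat τ θ
    else (if π = θ then 1 else 0) -
      if θ = τ then Ring.inverse (F.mat τ σ) * F.mat π σ else 0

lemma CanCancel.changeOfBasisInv_mul (h : F.CanCancel σ τ) (hF : F.IsComplex) :
    F.changeOfBasisInv σ τ * F.changeOfBasis σ τ = 1 := by
  have hne := h.ne
  have ha := h.mul_inverse
  have hc := h.2.2.1
  ext1 π θ
  rw [Matrix.mul_apply, Matrix.one_apply]
  simp only [changeOfBasisInv, Matrix.of_apply]
  by_cases h1 : π = τ
  · subst h1
    simp only [if_true, ite_mul, zero_mul, sum_ite_eq', mem_univ]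
    rw [changeOfBasis_apply _ _ _ _ _ hc]
    by_cases hθ : θ = π
    · simp [hθ, mul_comm, ha]
    · simp [hθ, Ne.symm hθ, hne.symm]
  by_cases h2 : π = σ
  · subst h2
    simp only [h1, if_true, if_false, changeOfBasis_apply _ _ _ _ _ hc]
    by_cases hθ : θ = τ
    · subst hθ
      -- The $(\sigma,\tau)$ entry of the product is $a_{\tau\sigma}^{-1}\sum_\rho
      -- a_{\tau\rho}a_{\rho\sigma}$, which vanishes because $d^2=0$.
      have := congrFun (hF.mulVec_col π) θ
      rw [Matrix.mulVec, dotProduct] at this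
      simp only [if_true, mul_assoc, ← mul_sum]
      rw [this]; simp [hne]
    · by_cases hθ' : θ = π
      · subst hθ'
        simp [hθ, mul_comm, ha]
      · simp only [hθ, if_false, mul_sub, sum_sub_distrib, mul_ite, mul_one, mul_zero,
          sum_ite_eq', mem_univ, if_true, hθ', Ne.symm hθ', ne_eq, not_false_eq_true, and_true]
        linear_combination (-(Ring.inverse (F.mat τ π) * F.mat τ θ)) * ha
  · simp only [h1, h2, if_false, sub_mul, sum_sub_distrib, ite_mul, one_mul, zero_mul,
      sum_ite_eq, sum_ite_eq', mem_univ, if_true, changeOfBasis_apply _ _ _ _ _ hc]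
    by_cases hθ : θ = τ
    · subst hθ
      simp only [if_true, h1, if_false]
      linear_combination (-(F.mat π σ)) * ha
    · simp [hθ, Ne.symm hθ, hne.symm]

/-- The differentials after a standard cancellation. -/
lemma CanCancel.cancel_mat (h : F.CanCancel σ τ) (hF : F.IsComplex) (π θ : Finset (Fin q)) :
    (F.cancel σ τ).mat π θ =
      if π = σ ∨ θ = τ then 0
      else F.mat π θ - F.mat π σ * Ring.inverse (F.mat τ σ) * F.mat τ θ := by
  have ha := h.mul_inverse
  have hc := h.2.2.1
  by_cases hB : π ∈ F.basis \ {σ, τ} ∧ θ ∈ F.basis \ {σ, τ} ∧ θ.card = π.card + 1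
  · obtain ⟨hπ, hθ, -⟩ := id hB
    simp only [mem_sdiff, mem_insert, mem_singleton, not_or] at hπ hθ
    have hinv : (F.changeOfBasis σ τ)⁻¹ = F.changeOfBasisInv σ τ :=
      Matrix.inv_eq_left_inv (h.changeOfBasisInv_mul hF)
    have hl : ∀ ρ, (F.changeOfBasisInv σ τ * F.mat) π ρ =
        F.mat π ρ - Ring.inverse (F.mat τ σ) * F.mat π σ * F.mat τ ρ := by
      intro ρ
      simp only [Matrix.mul_apply, changeOfBasisInv, Matrix.of_apply, hπ.2.1, hπ.2.2, if_false,
        sub_mul, sum_sub_distrib, ite_mul, one_mul, zero_mul, sum_ite_eq, sum_ite_eq', mem_univ,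
        if_true]
    have : (F.cancel σ τ).mat π θ =
        ((F.changeOfBasis σ τ)⁻¹ * F.mat * F.changeOfBasis σ τ) π θ := if_pos hB
    rw [this, hinv, Matrix.mul_apply, if_neg (by tauto)]
    simp only [hl, changeOfBasis_apply _ _ _ _ _ hc, hθ.2.1, hθ.2.2, if_false, ne_eq,
      not_false_eq_true, and_true, mul_sub, sum_sub_distrib, mul_ite, mul_one, mul_zero,
      sum_ite_eq', mem_univ, if_true]
    linear_combination (F.mat τ θ * Ring.inverse (F.mat τ σ) * F.mat π σ) * ha
  · have : (F.cancel σ τ).mat π θ = 0 := if_neg hB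
    rw [this]
    split_ifs with h1
    · rfl
    rw [not_or] at h1
    -- The Schur complement vanishes by itself in row $\tau$ and column $\sigma$; only row $\sigma$
    -- and column $\tau$ have to be set to zero in the formula.
    by_cases h2 : π = τ
    · subst h2
      linear_combination (F.mat π θ) * ha
    by_cases h3 : θ = σ
    · subst h3
      linear_combination (F.mat π θ) * ha
    simp only [mem_sdiff, mem_insert, mem_singleton] at hB
    rw [F.mat_eq_zero π θ (by tauto)]
    by_cases h4 : F.mat π σ = 0
    · simp [h4]
    by_cases h5 : F.mat τ θ = 0
    · simp [h5]
    have h6 := not_imp_comm.1 (F.mat_eq_zero π σ) h4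
    have h7 := not_imp_comm.1 (F.mat_eq_zero τ θ) h5
    exact absurd ⟨⟨h6.1, by tauto⟩, ⟨h7.2.1, by tauto⟩, by omega⟩ hB

lemma CanCancel.cancel_aug (h : F.CanCancel σ τ) (θ : Finset (Fin q)) :
    (F.cancel σ τ).aug θ = if θ = τ then 0 else F.aug θ := by
  have hc := h.2.2.1
  have hσ : F.aug σ = 0 := F.aug_eq_zero _ (by omega)
  by_cases hB : θ ∈ F.basis \ {σ, τ} ∧ θ.card = 0
  · have : (F.cancel σ τ).aug θ = ∑ π, F.changeOfBasis σ τ π θ • F.aug π := if_pos hB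
    rw [this]
    simp only [mem_sdiff, mem_insert, mem_singleton, not_or] at hB
    simp only [changeOfBasis_apply _ _ _ _ _ hc, hB, if_false, sub_smul, sum_sub_distrib, ne_eq,
      not_false_eq_true, and_true, ite_smul, one_smul, zero_smul, sum_ite_eq', mem_univ, if_true]
    simp [hσ]
  · have : (F.cancel σ τ).aug θ = 0 := if_neg hB
    rw [this]
    split_ifs with h1
    · rfl
    by_cases h2 : θ = σ
    · rw [h2, hσ]
    · rw [F.aug_eq_zero]
      simp only [mem_sdiff, mem_insert, mem_singleton] at hB
      tauto

lemma CanCancel.isComplex_cancel (h : F.CanCancel σ τ) (hF : F.IsComplex) :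
    (F.cancel σ τ).IsComplex := by
  have ha := h.mul_inverse
  constructor
  · ext1 π θ
    rw [Matrix.mul_apply, Matrix.zero_apply]
    simp only [h.cancel_mat hF]
    by_cases hπ : π = σ
    · simp [hπ]
    by_cases hθ : θ = τ
    · simp [hθ]
    simp only [hπ, hθ, false_or, or_false]
    -- Where one factor is set to zero ($\rho=\tau$ or $\rho=\sigma$), the Schur complement in the
    -- other factor vanishes. So the product expands without case distinction, and each of the four
    -- sums over $\rho$ contains an entry of $d^2=0$.
    have key : ∀ ρ, ((if ρ = τ then 0 else
          F.mat π ρ - F.mat π σ * Ring.inverse (F.mat τ σ) * F.mat τ ρ) *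
        if ρ = σ then 0 else F.mat ρ θ - F.mat ρ σ * Ring.inverse (F.mat τ σ) * F.mat τ θ) =
        F.mat π ρ * F.mat ρ θ
          - (F.mat π ρ * F.mat ρ σ) * (Ring.inverse (F.mat τ σ) * F.mat τ θ)
          - (F.mat π σ * Ring.inverse (F.mat τ σ)) * (F.mat τ ρ * F.mat ρ θ)
          + (F.mat π σ * Ring.inverse (F.mat τ σ)) * (F.mat τ ρ * F.mat ρ σ) *
            (Ring.inverse (F.mat τ σ) * F.mat τ θ) := by
      intro ρ
      split_ifs with h1 h2 h2
      · exact absurd (h2.symm.trans h1) h.ne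
      · subst h1
        linear_combination (F.mat π ρ * F.mat ρ θ - F.mat π σ * Ring.inverse (F.mat ρ σ) *
          F.mat ρ ρ * F.mat ρ θ) * ha
      · subst h2
        linear_combination (F.mat π ρ * F.mat ρ θ - F.mat π ρ * F.mat ρ ρ *
          Ring.inverse (F.mat τ ρ) * F.mat τ θ) * ha
      · ring
    have hz : ∀ a b, ∑ ρ, F.mat a ρ * F.mat ρ b = 0 := fun a b =>
      congrFun (congrFun hF.mat_mul_mat a) b
    simp only [key, sum_add_distrib, sum_sub_distrib, ← sum_mul, ← mul_sum, hz]
    ring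
  · intro θ
    simp only [h.cancel_mat hF, h.cancel_aug]
    by_cases hθ : θ = τ
    · simp [hθ]
    have hc := h.2.2.1
    have hσ : F.aug σ = 0 := F.aug_eq_zero _ (by omega)
    have key : ∀ π, ((if π = σ ∨ θ = τ then 0
        else F.mat π θ - F.mat π σ * Ring.inverse (F.mat τ σ) * F.mat τ θ) •
          if π = τ then 0 else F.aug π) = F.mat π θ • F.aug π -
            (Ring.inverse (F.mat τ σ) * F.mat τ θ) • F.mat π σ • F.aug π := by
      intro π
      by_cases h1 : π = σ
      · simp [h1, hσ]
      by_cases h2 : π = τ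
      · subst h2
        rw [if_pos rfl, smul_zero, ← mul_smul, ← sub_smul]
        rw [show F.mat π θ - Ring.inverse (F.mat π σ) * F.mat π θ * F.mat π σ = 0 by
          linear_combination (-F.mat π θ) * ha, zero_smul]
      · simp only [h1, h2, hθ, or_self, if_false, sub_smul, ← mul_smul]
        congr 2
        ring
    simp only [key, sum_sub_distrib, ← smul_sum, hF.mat_aug]
    simp

lemma CanCancel.isHomogeneousMat_cancel {l : Fin q → ι →₀ ℕ} (h : F.CanCancel σ τ)
    (hF : F.IsComplex) (hl : F.IsHomogeneousMat l) : (F.cancel σ τ).IsHomogeneousMat l := by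
  intro π θ
  rw [h.cancel_mat hF]
  split_ifs
  · exact IsHomogeneousEntry.zero
  · exact (hl π θ).sub (((hl π σ).mul ((hl τ σ).inverse h.2.2.2)).mul (hl τ θ))

end cancel

end FramedComplex

/-! ### A cancellation splits off a short complex -/

namespace FramedComplex

variable {ι k : Type*} [Field k] {q : ℕ} {M : Ideal (MvPolynomial ι k)}

/-- `T = F ⊕ (0 → S[σ] → S[τ] → 0)`, where `p = (σ, τ)`. -/
def SplitsOff (T F : FramedComplex q M) (l : Fin q → ι →₀ ℕ)
    (p : Finset (Fin q) × Finset (Fin q)) : Prop :=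
  ∃ e : ∀ j, T.X j ≃ₗ[MvPolynomial ι k] (F.X j × (short M p).X j),
    (∀ j (x : T.X (j + 1)),
      e j (T.d j x) = (F.d j (e (j + 1) x).1, (short M p).d j (e (j + 1) x).2)) ∧
    (∀ x : T.X 0, F.augmentation (e 0 x).1 = T.augmentation x) ∧
    (∀ j (m : ι →₀ ℕ) (x : T.X j), T.IsHomogeneousElt l m x →
      F.IsHomogeneousElt l m (e j x).1 ∧ (short M p).IsHomogeneousElt l m (e j x).2)

section split

variable {F : FramedComplex q M} {σ τ : Finset (Fin q)}

/-- The coordinates of an element with respect to the changed basis. -/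
noncomputable def splitMap (F : FramedComplex q M) (σ τ : Finset (Fin q)) (j : ℕ) :
    F.X j →ₗ[MvPolynomial ι k] ((F.cancel σ τ).X j × (short M (σ, τ)).X j) where
  toFun x :=
    -- The coefficient of $[\tau]'$ is $a_{\tau\sigma}^{-1}x_\tau$, whose contribution to the other
    -- coordinates is subtracted. The coefficient of $[\sigma]$ is
    -- $x_\sigma+\sum_{\theta\ne\sigma}a_{\tau\sigma}^{-1}a_{\tau\theta}x_\theta=a_{\tau\sigma}^{-1}(dx)_\tau$.
    (fun θ => F.ext0 x θ.1 - Ring.inverse (F.mat τ σ) * F.ext0 x τ * F.mat θ.1 σ,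
      fun ρ => Ring.inverse (F.mat τ σ) *
        if ρ.1 = σ then F.mat.mulVec (F.ext0 x) τ else F.ext0 x τ)
  map_add' x y := by
    refine Prod.ext (funext fun θ => ?_) (funext fun ρ => ?_)
    · simp only [ext0_add, Pi.add_apply, Prod.fst_add]
      ring
    · simp only [ext0_add, Pi.add_apply, Prod.snd_add, Matrix.mulVec_add]
      split_ifs <;> ring
  map_smul' r x := by
    refine Prod.ext (funext fun θ => ?_) (funext fun ρ => ?_)
    · simp only [ext0_smul, Pi.smul_apply, Prod.smul_fst, smul_eq_mul, RingHom.id_apply]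
      ring
    · simp only [ext0_smul, Pi.smul_apply, Prod.smul_snd, Matrix.mulVec_smul, smul_eq_mul,
        RingHom.id_apply]
      split_ifs <;> ring

lemma CanCancel.ext0_splitMap_fst (h : F.CanCancel σ τ) {j : ℕ} (x : F.X j) :
    (F.cancel σ τ).ext0 (F.splitMap σ τ j x).1 =
      F.ext0 x - (Ring.inverse (F.mat τ σ) * F.ext0 x τ) • (fun π => F.mat π σ) -
        F.ext0 x σ • Pi.single σ 1 := by
  have ha := h.mul_inverse
  have hc := h.2.2.1
  rw [← (F.cancel σ τ).ext0_eq_of_support (j := j) (F.ext0 x -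
    (Ring.inverse (F.mat τ σ) * F.ext0 x τ) • (fun π => F.mat π σ) - F.ext0 x σ • Pi.single σ 1)]
  · congr 1
    funext θ
    have hθ := θ.2.1
    change θ.1 ∈ F.basis \ {σ, τ} at hθ
    simp only [mem_sdiff, mem_insert, mem_singleton, not_or] at hθ
    simp [splitMap, hθ.2.1]
  · intro θ hθ
    replace hθ : ¬ (θ ∈ F.basis \ {σ, τ} ∧ θ.card = j) := hθ
    simp only [mem_sdiff, mem_insert, mem_singleton] at hθ
    simp only [Pi.sub_apply, Pi.smul_apply, smul_eq_mul]
    by_cases h1 : θ = σ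
    · subst h1
      simp [mat_self]
    by_cases h2 : θ = τ
    · subst h2
      rw [Pi.single_eq_of_ne h1]
      linear_combination (-F.ext0 x θ) * ha
    rw [Pi.single_eq_of_ne h1, F.ext0_of_not x (by tauto)]
    by_cases h3 : F.mat θ σ = 0
    · simp [h3]
    have h4 := not_imp_comm.1 (F.mat_eq_zero θ σ) h3
    rw [F.ext0_of_not (σ := τ) x (fun h' => hθ ⟨⟨h4.1, by tauto⟩, by omega⟩)]
    ring

lemma ext0_short {p : Finset (Fin q) × Finset (Fin q)} {j : ℕ} (s : (short M p).X j)
    {ρ : Finset (Fin q)} (h : ¬ ρ.card = j) : (short M p).ext0 s ρ = 0 :=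
  ext0_of_not _ _ fun h' => h h'.2

lemma CanCancel.splitMap_mulVec (h : F.CanCancel σ τ) (hF : F.IsComplex) {j : ℕ} (x : F.X j) :
    F.mat.mulVec ((F.cancel σ τ).ext0 (F.splitMap σ τ j x).1) =
      F.mat.mulVec (F.ext0 x) - F.ext0 x σ • fun π => F.mat π σ := by
  rw [h.ext0_splitMap_fst, Matrix.mulVec_sub, Matrix.mulVec_sub, Matrix.mulVec_smul,
    Matrix.mulVec_smul, hF.mulVec_col, smul_zero, sub_zero, Matrix.mulVec_single_one]
  rfl

/-- The $[\tau]$ coordinate of the short part gives $x_\tau=0$; then $x$ is a multiple of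
$[\sigma]$, and the $[\sigma]$ coordinate of the short part recovers that multiple. -/
lemma CanCancel.splitMap_injective (h : F.CanCancel σ τ) (j : ℕ) :
    Function.Injective (F.splitMap σ τ j) := by
  have ha := h.mul_inverse
  have hc := h.2.2.1
  have hs : σ ∈ (short M (σ, τ)).basis := mem_insert_self _ _
  have ht : τ ∈ (short M (σ, τ)).basis := mem_insert_of_mem (mem_singleton_self _)
  rw [injective_iff_map_eq_zero]
  intro x hx
  have h1 := h.ext0_splitMap_fst x
  rw [hx, Prod.fst_zero, ext0_zero] at h1
  have h2 : F.ext0 x τ = 0 := by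
    by_cases hj : τ.card = j
    · have := congrFun (congrArg Prod.snd hx) ⟨τ, ht, hj⟩
      simp only [splitMap, LinearMap.coe_mk, AddHom.coe_mk, h.ne.symm, if_false, Prod.snd_zero,
        Pi.zero_apply] at this
      linear_combination F.mat τ σ * this - F.ext0 x τ * ha
    · exact F.ext0_of_not x fun h' => hj h'.2
  rw [h2, mul_zero, zero_smul, sub_zero, eq_comm, sub_eq_zero] at h1
  have h3 : F.ext0 x σ = 0 := by
    by_cases hj : σ.card = j
    · have := congrFun (congrArg Prod.snd hx) ⟨σ, hs, hj⟩
      simp only [splitMap, LinearMap.coe_mk, AddHom.coe_mk, if_true, Prod.snd_zero,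
        Pi.zero_apply] at this
      rw [h1, Matrix.mulVec_smul, Matrix.mulVec_single_one] at this
      simp only [Pi.smul_apply, smul_eq_mul, Matrix.col_apply] at this
      linear_combination this - F.ext0 x σ * ha
    · exact F.ext0_of_not x fun h' => hj h'.2
  rw [h3, zero_smul] at h1
  exact F.ext0_injective (h1.trans F.ext0_zero.symm)

lemma CanCancel.splitMap_surjective (h : F.CanCancel σ τ) (hF : F.IsComplex) (j : ℕ) :
    Function.Surjective (F.splitMap σ τ j) := by
  have ha := h.mul_inverse
  have hc := h.2.2.1
  rintro ⟨y, s⟩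
  set y' := (F.cancel σ τ).ext0 y with hy'
  set s' := (short M (σ, τ)).ext0 s with hs'
  have hyσ : y' σ = 0 := (F.cancel σ τ).ext0_of_not y fun h' => by
    have := h'.1
    change σ ∈ F.basis \ {σ, τ} at this
    simp at this
  have hyτ : y' τ = 0 := (F.cancel σ τ).ext0_of_not y fun h' => by
    have := h'.1
    change τ ∈ F.basis \ {σ, τ} at this
    simp at this
  -- The preimage is $y+s_\tau\,d[\sigma]+b[\sigma]$, with $b$ chosen so that $a_{\tau\sigma}^{-1}$
  -- times the $\tau$ coordinate of its differential equals $s_\sigma$; the term $d[\sigma]$ does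
  -- not contribute, as $d^2=0$.
  set b := s' σ - Ring.inverse (F.mat τ σ) * F.mat.mulVec y' τ with hb
  set f : Finset (Fin q) → MvPolynomial ι k :=
    y' + s' τ • (fun π => F.mat π σ) + b • Pi.single σ 1 with hf
  have hsupp : ∀ θ, ¬ (θ ∈ F.basis ∧ θ.card = j) → f θ = 0 := by
    intro θ hθ
    have e1 : y' θ = 0 := (F.cancel σ τ).ext0_of_not y fun h' => hθ
      ⟨(mem_sdiff.1 (show θ ∈ F.basis \ {σ, τ} from h'.1)).1, h'.2⟩
    have e2 : s' τ * F.mat θ σ = 0 := by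
      by_cases hj : τ.card = j
      · rw [F.mat_eq_zero, mul_zero]
        rintro ⟨h1, -, h3⟩
        exact hθ ⟨h1, by omega⟩
      · rw [hs', ext0_short s hj, zero_mul]
    have e3 : b * (Pi.single σ 1 : Finset (Fin q) → MvPolynomial ι k) θ = 0 := by
      by_cases hθσ : θ = σ
      · subst hθσ
        have hj : θ.card ≠ j := fun h' => hθ ⟨h.1, h'⟩
        have : F.mat.mulVec y' τ = 0 := by
          rw [Matrix.mulVec, dotProduct]
          refine sum_eq_zero fun ρ _ => ?_
          by_cases hρ : ρ.card = j
          · rw [F.mat_eq_zero_of_card (by omega), zero_mul]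
          · rw [hy', ext0_of_not _ _ fun h' => hρ h'.2, mul_zero]
        rw [hb, this, hs', ext0_short s hj]
        ring
      · rw [Pi.single_eq_of_ne hθσ, mul_zero]
    simp only [hf, Pi.add_apply, Pi.smul_apply, smul_eq_mul, e1, e2, e3, add_zero]
  have hfx := F.ext0_eq_of_support (j := j) f hsupp
  have hfτ : f τ = F.mat τ σ * s' τ := by
    simp only [hf, Pi.add_apply, Pi.smul_apply, smul_eq_mul, hyτ, Pi.single_eq_of_ne h.ne.symm]
    ring
  have hfmul : F.mat.mulVec f = F.mat.mulVec y' + b • fun π => F.mat π σ := by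
    rw [hf, Matrix.mulVec_add, Matrix.mulVec_add, Matrix.mulVec_smul,
      Matrix.mulVec_smul, hF.mulVec_col, smul_zero, add_zero, Matrix.mulVec_single_one]
    rfl
  refine ⟨fun θ => f θ.1, Prod.ext (funext fun θ => ?_) (funext fun ρ => ?_)⟩
  · have hθ := θ.2.1
    change θ.1 ∈ F.basis \ {σ, τ} at hθ
    simp only [mem_sdiff, mem_insert, mem_singleton, not_or] at hθ
    simp only [splitMap, LinearMap.coe_mk, AddHom.coe_mk, hfx, hfτ]
    have : f θ.1 = y θ + s' τ * F.mat θ.1 σ := by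
      simp only [hf, Pi.add_apply, Pi.smul_apply, smul_eq_mul, Pi.single_eq_of_ne hθ.2.1, hy',
        ext0_coe]
      ring
    rw [this]
    linear_combination (-(s' τ * F.mat θ.1 σ)) * ha
  · simp only [splitMap, LinearMap.coe_mk, AddHom.coe_mk, hfx, hfτ, hfmul]
    rw [← (short M (σ, τ)).ext0_coe s ρ, ← hs']
    split_ifs with h1
    · rw [h1]
      simp only [Pi.add_apply, Pi.smul_apply, smul_eq_mul]
      linear_combination b * ha + hb
    · have h2 := ρ.2.1
      change ρ.1 ∈ ({σ, τ} : Finset _) at h2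
      have h3 : ρ.1 = τ := by simpa [h1] using h2
      rw [h3]
      linear_combination s' τ * ha

lemma CanCancel.splitMap_bijective (h : F.CanCancel σ τ) (hF : F.IsComplex) (j : ℕ) :
    Function.Bijective (F.splitMap σ τ j) :=
  ⟨h.splitMap_injective j, h.splitMap_surjective hF j⟩

/-- A standard cancellation splits off a short complex as a direct summand. -/
theorem CanCancel.splitsOff {l : Fin q → ι →₀ ℕ} (h : F.CanCancel σ τ) (hF : F.IsComplex)
    (hl : F.IsHomogeneousMat l) : F.SplitsOff (F.cancel σ τ) l (σ, τ) := by
  have ha := h.mul_inverse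
  have hc := h.2.2.1
  refine ⟨fun j => LinearEquiv.ofBijective (F.splitMap σ τ j)
    (h.splitMap_bijective hF j), ?_, ?_, ?_⟩
  · intro j x
    simp only [LinearEquiv.ofBijective_apply]
    refine Prod.ext (funext fun π => ?_) (funext fun ρ => ?_)
    · have hπ := π.2.1
      change π.1 ∈ F.basis \ {σ, τ} at hπ
      simp only [mem_sdiff, mem_insert, mem_singleton, not_or] at hπ
      change (F.splitMap σ τ j (F.d j x)).1 π =
        (F.cancel σ τ).d j (F.splitMap σ τ (j + 1) x).1 π
      rw [d_apply]
      set y := (F.cancel σ τ).ext0 (F.splitMap σ τ (j + 1) x).1 with hy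
      have hyτ : y τ = 0 := ext0_of_not _ _ fun h' => by
        have := h'.1
        change τ ∈ F.basis \ {σ, τ} at this
        simp at this
      have h1 : (F.cancel σ τ).mat.mulVec y π.1 = F.mat.mulVec y π.1 -
          F.mat π.1 σ * Ring.inverse (F.mat τ σ) * F.mat.mulVec y τ := by
        simp only [Matrix.mulVec, dotProduct, mul_sum, ← sum_sub_distrib]
        refine sum_congr rfl fun θ _ => ?_
        rw [h.cancel_mat hF]
        by_cases hθ : θ = τ
        · simp [hθ, hyτ]
        · rw [if_neg (by tauto)]
          ring
      rw [h1, h.splitMap_mulVec hF]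
      simp only [splitMap, LinearMap.coe_mk, AddHom.coe_mk, ext0_d, Pi.sub_apply, Pi.smul_apply,
        smul_eq_mul]
      linear_combination (-F.ext0 x σ * F.mat π.1 σ) * ha
    · change (F.splitMap σ τ j (F.d j x)).2 ρ =
        (short M (σ, τ)).d j (F.splitMap σ τ (j + 1) x).2 ρ
      rw [d_apply]
      have h2 := ρ.2.1
      change ρ.1 ∈ ({σ, τ} : Finset _) at h2
      have hrhs : (short M (σ, τ)).mat.mulVec
          ((short M (σ, τ)).ext0 (F.splitMap σ τ (j + 1) x).2) ρ.1 =
          if ρ.1 = τ then (short M (σ, τ)).ext0 (F.splitMap σ τ (j + 1) x).2 σ else 0 := by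
        rw [Matrix.mulVec, dotProduct, sum_eq_single σ]
        · by_cases h3 : ρ.1 = τ <;> simp [short, h3, hc]
        · intro θ _ hθ
          simp [short, hθ]
        · simp
      rw [hrhs]
      simp only [splitMap, LinearMap.coe_mk, AddHom.coe_mk, ext0_d]
      by_cases h3 : ρ.1 = τ
      · have hj : σ.card = j + 1 := by rw [hc, ← h3, ρ.2.2]
        rw [if_neg (h3.symm ▸ h.ne.symm), if_pos h3]
        have := (short M (σ, τ)).ext0_coe (F.splitMap σ τ (j + 1) x).2
          ⟨σ, mem_insert_self _ _, hj⟩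
        simp only [splitMap, LinearMap.coe_mk, AddHom.coe_mk, if_true] at this
        exact this.symm
      -- Nothing maps to $[\sigma]$ in the short complex, and its coordinate here is
      -- $a_{\tau\sigma}^{-1}(d^2x)_\tau=0$.
      · have h4 : ρ.1 = σ := by simpa [h3] using h2
        rw [if_pos h4, if_neg h3, Matrix.mulVec_mulVec, hF.mat_mul_mat, Matrix.zero_mulVec]
        simp
  · intro x
    simp only [LinearEquiv.ofBijective_apply]
    rw [augmentation_apply, augmentation_apply]
    have hσ : F.aug σ = 0 := F.aug_eq_zero _ (by omega)
    set y := (F.cancel σ τ).ext0 (F.splitMap σ τ 0 x).1 with hy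
    have hyτ : y τ = 0 := ext0_of_not _ _ fun h' => by
      have := h'.1
      change τ ∈ F.basis \ {σ, τ} at this
      simp at this
    have h1 : ∀ θ, y θ • (F.cancel σ τ).aug θ = F.ext0 x θ • F.aug θ -
        (Ring.inverse (F.mat τ σ) * F.ext0 x τ) • F.mat θ σ • F.aug θ := by
      intro θ
      rw [h.cancel_aug]
      by_cases h2 : θ = σ
      · simp [h2, hσ]
      have h3 : y θ = F.ext0 x θ - Ring.inverse (F.mat τ σ) * F.ext0 x τ * F.mat θ σ := by
        rw [hy, h.ext0_splitMap_fst]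
        simp [h2]
      have h4 : y θ • F.aug θ = F.ext0 x θ • F.aug θ -
          (Ring.inverse (F.mat τ σ) * F.ext0 x τ) • F.mat θ σ • F.aug θ := by
        rw [h3, sub_smul, mul_smul]
      rw [← h4]
      split_ifs with h5
      · rw [h5, hyτ, zero_smul, zero_smul]
      · rfl
    simp only [h1, sum_sub_distrib, ← smul_sum, hF.mat_aug, smul_zero, sub_zero]
  · intro j m x hx
    simp only [LinearEquiv.ofBijective_apply]
    have hinv := (hl τ σ).inverse h.2.2.2
    refine ⟨fun θ => (hx.ext0 θ.1).sub ?_, fun ρ => ?_⟩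
    · rw [mul_comm, ← mul_assoc]
      exact ((hl θ.1 σ).mul hinv).mul (hx.ext0 τ)
    · have hst := (hl τ σ).eq_of_isUnit h.2.2.2
      have hτ : IsHomogeneousEntry (faceMdeg l σ) m (Ring.inverse (F.mat τ σ) * F.ext0 x τ) :=
        hinv.mul (hx.ext0 τ)
      have h2 := ρ.2.1
      change ρ.1 ∈ ({σ, τ} : Finset _) at h2
      change IsHomogeneousEntry _ _ (Ring.inverse (F.mat τ σ) *
        if ρ.1 = σ then F.mat.mulVec (F.ext0 x) τ else F.ext0 x τ)
      split_ifs with h1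
      · rw [h1]
        exact hinv.mul (IsHomogeneousEntry.sum _ _ fun θ _ => (hl τ θ).mul (hx.ext0 θ))
      · have h3 : ρ.1 = τ := by simpa [h1] using h2
        rw [h3, hst]
        exact hτ

end split

end FramedComplex

/-! ### Accumulating the split summands -/

/-- A family indexed by `insert a s` amounts to its member at `a` and a family indexed by `s`. -/
lemma exists_linearEquiv_pi_insert {R α : Type*} [Semiring R] [DecidableEq α] (N : α → Type*)
    [∀ a, AddCommMonoid (N a)] [∀ a, Module R (N a)] (s : Finset α) (a : α) (ha : a ∉ s) :
    ∃ g : (∀ p : ↥(insert a s), N p.1) ≃ₗ[R] (N a × ∀ p : ↥s, N p.1),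
      ∀ f, g f = (f ⟨a, mem_insert_self _ _⟩, fun p : ↥s => f ⟨p.1, mem_insert_of_mem p.2⟩) := by
  let g : (∀ p : ↥(insert a s), N p.1) →ₗ[R] (N a × ∀ p : ↥s, N p.1) :=
    { toFun := fun f => (f ⟨a, mem_insert_self _ _⟩, fun p => f ⟨p.1, mem_insert_of_mem p.2⟩)
      map_add' := fun _ _ => rfl
      map_smul' := fun _ _ => rfl }
  have hg : Function.Bijective g := by
    constructor
    · intro f f' h
      funext p
      rcases p with ⟨p, hp⟩
      rcases mem_insert.1 hp with rfl | hp'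
      · exact congrArg Prod.fst h
      · exact congrFun (congrArg Prod.snd h) ⟨p, hp'⟩
    · rintro ⟨x, y⟩
      refine ⟨fun p => if h : p.1 = a then cast (congrArg N h.symm) x
        else y ⟨p.1, (mem_insert.1 p.2).resolve_left h⟩, Prod.ext ?_ (funext fun p => ?_)⟩
      · exact dif_pos rfl
      · exact dif_neg fun h : p.1 = a => ha (h ▸ p.2)
  exact ⟨LinearEquiv.ofBijective g hg, fun _ => rfl⟩

namespace FramedComplex

variable {ι k : Type*} [Field k] {q : ℕ} {M : Ideal (MvPolynomial ι k)}

lemma IsDirectSumWith.refl (F : FramedComplex q M) (l : Fin q → ι →₀ ℕ) :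
    F.IsDirectSumWith F l ∅ := by
  have : ∀ j, ∃ e : F.X j ≃ₗ[MvPolynomial ι k]
      (F.X j × (∀ p : (∅ : Finset (Finset (Fin q) × Finset (Fin q))), (short M p.1).X j)),
      ∀ x, e x = (x, 0) := by
    intro j
    refine ⟨LinearEquiv.ofBijective (LinearMap.inl _ _ _) ⟨LinearMap.inl_injective, ?_⟩,
      fun _ => rfl⟩
    rintro ⟨x, y⟩
    exact ⟨x, Prod.ext rfl (Subsingleton.elim _ _)⟩
  choose e he using this
  refine ⟨e, fun j x => ?_, fun x => ?_, fun j m x hx => ?_⟩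
  · exact Prod.ext (by simp [he]) (Subsingleton.elim _ _)
  · simp [he]
  · exact ⟨by simpa [he] using hx, fun p => absurd p.2 (notMem_empty _)⟩

lemma SplitsOff.isDirectSumWith {T F F' : FramedComplex q M} {l : Fin q → ι →₀ ℕ}
    {p : Finset (Fin q) × Finset (Fin q)} {A : Finset (Finset (Fin q) × Finset (Fin q))}
    (h : T.SplitsOff F l p) (h' : F.IsDirectSumWith F' l A) (hp : p ∉ A) :
    T.IsDirectSumWith F' l (insert p A) := by
  obtain ⟨e, he1, he2, he3⟩ := h
  obtain ⟨e', he1', he2', he3'⟩ := h'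
  have : ∀ j, ∃ E : T.X j ≃ₗ[MvPolynomial ι k]
      (F'.X j × (∀ p' : ↥(insert p A), (short M p'.1).X j)), ∀ x,
      (E x).1 = (e' j (e j x).1).1 ∧ (E x).2 ⟨p, mem_insert_self _ _⟩ = (e j x).2 ∧
      ∀ p' : A, (E x).2 ⟨p'.1, mem_insert_of_mem p'.2⟩ = (e' j (e j x).1).2 p' := by
    intro j
    obtain ⟨g, hg⟩ := exists_linearEquiv_pi_insert (R := MvPolynomial ι k)
      (fun p' => (short M p').X j) A p hp
    refine ⟨(e j).trans ((LinearEquiv.prodCongr (e' j) (LinearEquiv.refl _ _)).trans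
      ((LinearEquiv.prodAssoc _ _ _ _).trans (LinearEquiv.prodCongr (LinearEquiv.refl _ _)
        ((LinearEquiv.prodComm _ _ _).trans g.symm)))), fun x => ?_⟩
    have key := (hg (g.symm ((e j x).2, (e' j (e j x).1).2))).symm
    rw [g.apply_symm_apply] at key
    exact ⟨rfl, congrArg Prod.fst key, fun p' => congrFun (congrArg Prod.snd key) p'⟩
  choose E hE1 hE2 hE3 using this
  refine ⟨E, fun j x => ?_, fun x => ?_, fun j m x hx => ?_⟩
  · refine Prod.ext ?_ (funext ?_)
    · simp only [hE1, he1, he1']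
    · rintro ⟨p', hp'⟩
      rcases mem_insert.1 hp' with rfl | hA
      · simp only [hE2, he1]
      · have h1 := hE3 j (T.d j x) ⟨p', hA⟩
        have h2 := hE3 (j + 1) x ⟨p', hA⟩
        simp only [he1, he1'] at h1
        simp only [h1, h2]
  · rw [hE1, he2', he2]
  · obtain ⟨h1, h2⟩ := he3 j m x hx
    obtain ⟨h3, h4⟩ := he3' j m _ h1
    refine ⟨by rw [hE1]; exact h3, ?_⟩
    rintro ⟨p', hp'⟩
    rcases mem_insert.1 hp' with rfl | hA
    · rw [hE2]; exact h2
    · rw [hE3 j x ⟨p', hA⟩]; exact h4 ⟨p', hA⟩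

/-! ### Exactness of a direct summand -/

section transfer

variable {T F : FramedComplex q M} {l : Fin q → ι →₀ ℕ}
    {A : Finset (Finset (Fin q) × Finset (Fin q))}

lemma IsDirectSumWith.surjective_augmentation (h : T.IsDirectSumWith F l A)
    (hT : Function.Surjective T.augmentation) : Function.Surjective F.augmentation := by
  obtain ⟨e, -, he, -⟩ := h
  intro z
  obtain ⟨x, rfl⟩ := hT z
  exact ⟨_, he x⟩

/-- An element $x$ of the summand is tested as $(x,0)$, and a preimage of $(x,0)$ is projected back
to the summand. -/
lemma IsDirectSumWith.exact_zero (h : T.IsDirectSumWith F l A)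
    (hT : Function.Exact (T.d 0) T.augmentation) : Function.Exact (F.d 0) F.augmentation := by
  obtain ⟨e, he, he', -⟩ := h
  intro x
  have hx : F.augmentation x = T.augmentation ((e 0).symm (x, 0)) := by
    rw [← he', (e 0).apply_symm_apply]
  rw [hx, hT]
  constructor
  · rintro ⟨y, hy⟩
    refine ⟨(e 1 y).1, ?_⟩
    have := he 0 y
    rw [hy, (e 0).apply_symm_apply] at this
    exact (congrArg Prod.fst this).symm
  · rintro ⟨y, rfl⟩
    refine ⟨(e 1).symm (y, 0), (e 0).injective ?_⟩
    rw [he, (e 0).apply_symm_apply]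
    simp only [LinearEquiv.apply_symm_apply, Pi.zero_apply, map_zero]
    rfl

lemma IsDirectSumWith.exact_succ (h : T.IsDirectSumWith F l A) (j : ℕ)
    (hT : Function.Exact (T.d (j + 1)) (T.d j)) : Function.Exact (F.d (j + 1)) (F.d j) := by
  obtain ⟨e, he, -⟩ := h
  intro x
  have hx : F.d j x = 0 ↔ T.d j ((e (j + 1)).symm (x, 0)) = 0 := by
    rw [← (e j).map_eq_zero_iff, he, (e (j + 1)).apply_symm_apply]
    simp only [Pi.zero_apply, map_zero, Prod.mk_eq_zero]
    exact ⟨fun h => ⟨h, rfl⟩, fun h => h.1⟩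
  rw [hx, hT]
  constructor
  · rintro ⟨y, hy⟩
    refine ⟨(e (j + 2) y).1, ?_⟩
    have := he (j + 1) y
    rw [hy, (e (j + 1)).apply_symm_apply] at this
    exact (congrArg Prod.fst this).symm
  · rintro ⟨y, rfl⟩
    refine ⟨(e (j + 2)).symm (y, 0), (e (j + 1)).injective ?_⟩
    rw [he, (e (j + 1)).apply_symm_apply]
    simp only [LinearEquiv.apply_symm_apply, Pi.zero_apply, map_zero]
    rfl

end transfer

/-! ### Successive cancellations and minimality -/

/-- Standard cancellations along disjoint pairs can be made in any order if pairs of the same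
multidegree lie in different homological degrees. -/
theorem exists_cancelSeq (l : Fin q → ι →₀ ℕ)
    (L : List (Finset (Fin q) × Finset (Fin q))) (F : FramedComplex q M) (hF : F.IsComplex)
    (hl : F.IsHomogeneousMat l) (hL : ∀ p ∈ L, F.CanCancel p.1 p.2)
    (hdisj : L.Pairwise fun p p' => p.1 ≠ p'.1 ∧ p.1 ≠ p'.2 ∧ p.2 ≠ p'.1 ∧ p.2 ≠ p'.2)
    (hdeg : L.Pairwise fun p p' => faceMdeg l p.1 = faceMdeg l p'.1 → p.1.card ≠ p'.1.card) :
    ∃ F' : FramedComplex q M, CancelSeq F L F' ∧ F.IsDirectSumWith F' l L.toFinset ∧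
      F'.IsHomogeneousMat l ∧ (∀ θ, F'.aug θ = F.aug θ ∨ F'.aug θ = 0) ∧
      ∀ θ ∈ F'.basis, θ ∈ F.basis ∧ ∀ p ∈ L, θ ≠ p.1 ∧ θ ≠ p.2 := by
  induction L generalizing F with
  | nil => exact ⟨F, .nil F, .refl F l, hl, fun _ => .inl rfl, fun θ hθ => ⟨hθ, by simp⟩⟩
  | cons p L ih =>
    obtain ⟨σ, τ⟩ := p
    rw [List.pairwise_cons] at hdisj hdeg
    have h : F.CanCancel σ τ := hL _ List.mem_cons_self
    have hL' : ∀ p ∈ L, (F.cancel σ τ).CanCancel p.1 p.2 := by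
      rintro ⟨σ', τ'⟩ hp
      obtain ⟨h1, h2, h3, h4⟩ := hL _ (List.mem_cons_of_mem _ hp)
      obtain ⟨d1, d2, d3, d4⟩ := hdisj.1 _ hp
      have hd := hdeg.1 _ hp
      simp only at h1 h2 h3 h4 d1 d2 d3 d4 hd ⊢
      refine ⟨?_, ?_, h3, ?_⟩
      · exact mem_sdiff.2 ⟨h1, by simp [d1.symm, d3.symm]⟩
      · exact mem_sdiff.2 ⟨h2, by simp [d2.symm, d4.symm]⟩
      rw [h.cancel_mat hF, if_neg (by tauto)]
      -- A nonzero correction would give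
      -- $\operatorname{mdeg}\tau'\le\operatorname{mdeg}\sigma=\operatorname{mdeg}\tau\le\operatorname{mdeg}\sigma'=\operatorname{mdeg}\tau'$
      -- and equal sizes of $\sigma,\sigma'$. So the entry of every later pair is unchanged, not
      -- merely still invertible.
      suffices F.mat τ' σ * Ring.inverse (F.mat τ σ) * F.mat τ σ' = 0 by rwa [this, sub_zero]
      by_contra hne
      have n1 : F.mat τ' σ ≠ 0 := fun h0 => hne (by simp [h0])
      have n2 : F.mat τ σ' ≠ 0 := fun h0 => hne (by simp [h0])
      have c1 := (not_imp_comm.1 (F.mat_eq_zero τ' σ) n1).2.2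
      have m1 := (hl τ' σ).eq_zero_or_le.resolve_left n1
      have m2 := (hl τ σ').eq_zero_or_le.resolve_left n2
      rw [(hl τ' σ').eq_of_isUnit h4] at m1
      rw [(hl τ σ).eq_of_isUnit h.2.2.2] at m2
      exact hd (le_antisymm m2 m1) (by omega)
    obtain ⟨F', hs, hsum, hl', haug, hbasis⟩ := ih (F.cancel σ τ) (h.isComplex_cancel hF)
      (h.isHomogeneousMat_cancel hF hl) hL' hdisj.2 hdeg.2
    refine ⟨F', .cons F F' σ τ L h hs, ?_, hl', fun θ => ?_, fun θ hθ => ?_⟩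
    · rw [List.toFinset_cons]
      refine (h.splitsOff hF hl).isDirectSumWith hsum fun hmem => ?_
      exact (hdisj.1 _ (List.mem_toFinset.1 hmem)).1 rfl
    · have := haug θ
      rw [h.cancel_aug] at this
      split_ifs at this <;> tauto
    · obtain ⟨h1, h2⟩ := hbasis θ hθ
      have h3 := mem_sdiff.1 (show θ ∈ F.basis \ {σ, τ} from h1)
      simp only [mem_insert, mem_singleton, not_or] at h3
      refine ⟨h3.1, fun p hp => ?_⟩
      rcases List.mem_cons.1 hp with rfl | hp
      exacts [h3.2, h2 p hp]

/-- A homogeneous complex without basis elements of equal multidegree in consecutive homological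
degrees is minimal. -/
lemma isMinimal_of_faceMdeg_ne {F : FramedComplex q M} {l : Fin q → ι →₀ ℕ}
    (hl : F.IsHomogeneousMat l)
    (h : ∀ τ ∈ F.basis, ∀ σ ∈ F.basis, σ.card = τ.card + 1 → faceMdeg l τ ≠ faceMdeg l σ) :
    F.IsMinimal := by
  rintro j _ ⟨x, rfl⟩
  rw [pi_eq_sum_univ' (F.d j x)]
  refine Submodule.sum_mem _ fun τ _ => Submodule.smul_mem_smul ?_ trivial
  rw [d_apply, Matrix.mulVec, dotProduct]
  refine Ideal.sum_mem _ fun σ _ => Ideal.mul_mem_right _ _ ?_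
  by_cases hσ : F.mat τ.1 σ = 0
  · rw [hσ]; exact Ideal.zero_mem _
  · obtain ⟨h1, h2, h3⟩ := not_imp_comm.1 (F.mat_eq_zero τ.1 σ) hσ
    exact (hl _ _).mem_span_X (h _ h1 _ h2 h3)

end FramedComplex

/-! ### Compositions of maps, multidegrees and signs -/

namespace FramedComplex

variable {ι k : Type*} [Field k] {q : ℕ} {M : Ideal (MvPolynomial ι k)}

lemma IsComplex.d_d {F : FramedComplex q M} (hF : F.IsComplex) (j : ℕ) (x : F.X (j + 2)) :
    F.d j (F.d (j + 1) x) = 0 := by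
  apply F.ext0_injective
  rw [ext0_d, ext0_d, Matrix.mulVec_mulVec, hF.mat_mul_mat, Matrix.zero_mulVec, ext0_zero]

lemma IsComplex.augmentation_d {F : FramedComplex q M} (hF : F.IsComplex) (x : F.X 1) :
    F.augmentation (F.d 0 x) = 0 := by
  rw [augmentation_apply, ext0_d]
  simp only [Matrix.mulVec, dotProduct, sum_smul]
  rw [sum_comm]
  refine sum_eq_zero fun θ _ => ?_
  simp only [mul_comm _ (F.ext0 x θ), mul_smul, ← smul_sum, hF.mat_aug, smul_zero]

end FramedComplex

section faceMdeg

variable {ι : Type*} {q : ℕ} (l : Fin q → ι →₀ ℕ)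

lemma faceMdeg_mono {τ σ : Finset (Fin q)} (h : τ ⊆ σ) : faceMdeg l τ ≤ faceMdeg l σ :=
  sup_mono h

lemma faceMdeg_empty : faceMdeg l ∅ = 0 := rfl

lemma faceMdeg_singleton (i : Fin q) : faceMdeg l {i} = l i := sup_singleton ..

lemma faceMdeg_insert (i : Fin q) (σ : Finset (Fin q)) :
    faceMdeg l (insert i σ) = l i ⊔ faceMdeg l σ := sup_insert ..

lemma le_faceMdeg {i : Fin q} {σ : Finset (Fin q)} (h : i ∈ σ) : l i ≤ faceMdeg l σ := le_sup h

end faceMdeg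

lemma Ideal.Quotient.smul_one_eq_mk {R : Type*} [CommRing R] (I : Ideal R) (r : R) :
    r • (1 : R ⧸ I) = Ideal.Quotient.mk I r :=
  congrArg (Ideal.Quotient.mk I) (mul_one r)

lemma MvPolynomial.coeff_neg_one_pow_mul {ι k : Type*} [CommRing k] (n : ℕ) (m : ι →₀ ℕ)
    (p : MvPolynomial ι k) :
    MvPolynomial.coeff m ((-1) ^ n * p) = (-1) ^ n * MvPolynomial.coeff m p := by
  rcases n.even_or_odd with h | h <;> simp [h.neg_one_pow]

lemma MvPolynomial.monomial_neg_one_pow {ι k : Type*} [CommRing k] (n : ℕ) (m : ι →₀ ℕ) :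
    MvPolynomial.monomial m ((-1 : k) ^ n) = (-1) ^ n * MvPolynomial.monomial m 1 := by
  rcases n.even_or_odd with h | h <;> simp [h.neg_one_pow]

/-! ### The Taylor resolution -/

namespace FramedComplex

variable {ι k : Type*} [Field k] {q : ℕ} (M : Ideal (MvPolynomial ι k)) (l : Fin q → ι →₀ ℕ)

lemma taylor_mat_apply (τ σ : Finset (Fin q)) :
    (taylor M l).mat τ σ = ∑ i, if i ∉ τ ∧ σ = insert i τ then
      MvPolynomial.monomial (faceMdeg l (insert i τ) - faceMdeg l τ)
        ((-1 : k) ^ #{i' ∈ τ | i' < i}) else 0 := by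
  change ∑ i ∈ σ, _ = _
  rw [← sum_filter_add_sum_filter_not univ (· ∈ σ), filter_mem_eq_inter, univ_inter]
  rw [sum_eq_zero (s := univ.filter (¬ · ∈ σ)), add_zero]
  · refine sum_congr rfl fun i hi => ?_
    by_cases h : τ = σ.erase i
    · subst h
      rw [if_pos rfl, if_pos ⟨notMem_erase _ _, (insert_erase hi).symm⟩, insert_erase hi]
      congr 3
      ext j
      simp only [mem_filter, mem_erase]
      exact ⟨fun h => ⟨⟨h.2.ne, h.1⟩, h.2⟩, fun h => ⟨h.1.2, h.2⟩⟩
    · rw [if_neg h, if_neg]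
      rintro ⟨h1, rfl⟩
      exact h (erase_insert h1).symm
  · intro i hi
    rw [if_neg]
    rintro ⟨-, rfl⟩
    simp at hi

/-- Scaling each coordinate by the monomial of its multidegree turns the Taylor differential into
the simplicial boundary. The scaling is injective, so identities may be checked after it. -/
lemma taylor_mulVec (f : Finset (Fin q) → MvPolynomial ι k) (τ : Finset (Fin q)) :
    MvPolynomial.monomial (faceMdeg l τ) 1 * (taylor M l).mat.mulVec f τ =
      simplexBoundary (fun σ => MvPolynomial.monomial (faceMdeg l σ) 1 * f σ) τ := by
  simp only [Matrix.mulVec, dotProduct, taylor_mat_apply, sum_mul]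
  rw [sum_comm, mul_sum, simplexBoundary]
  refine sum_congr rfl fun i _ => ?_
  by_cases hi : i ∈ τ
  · simp [hi]
  · simp only [hi, not_false_eq_true, true_and, ite_mul, zero_mul, sum_ite_eq', mem_univ, if_true,
      if_false]
    rw [← mul_assoc, MvPolynomial.monomial_mul, one_mul,
      add_tsub_cancel_of_le (faceMdeg_mono l (subset_insert _ _)),
      MvPolynomial.monomial_neg_one_pow, mul_assoc]

lemma taylor_mulVec_mulVec (f : Finset (Fin q) → MvPolynomial ι k) :
    (taylor M l).mat.mulVec ((taylor M l).mat.mulVec f) = 0 := by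
  funext τ
  have h : MvPolynomial.monomial (faceMdeg l τ) (1 : k) *
      (taylor M l).mat.mulVec ((taylor M l).mat.mulVec f) τ = 0 := by
    rw [taylor_mulVec]
    simp only [taylor_mulVec]
    exact congrFun (simplexBoundary_boundary _) τ
  exact (mul_eq_zero.1 h).resolve_left (by simp)

lemma taylor_isComplex (hM : ∀ i, MvPolynomial.monomial (l i) 1 ∈ M) : (taylor M l).IsComplex := by
  constructor
  · ext1 π θ
    have := congrFun (taylor_mulVec_mulVec M l (Pi.single θ 1)) π
    rw [Matrix.mulVec_mulVec, Matrix.mulVec_single_one] at this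
    exact this
  · intro θ
    change ∑ π, (taylor M l).mat π θ • (if π = ∅ then (1 : MvPolynomial ι k ⧸ M) else 0) = 0
    simp only [smul_ite, smul_zero, sum_ite_eq', mem_univ, if_true]
    rw [Ideal.Quotient.smul_one_eq_mk, Ideal.Quotient.eq_zero_iff_mem, taylor_mat_apply]
    refine Ideal.sum_mem _ fun i _ => ?_
    split_ifs
    · rw [insert_empty_eq, faceMdeg_singleton, faceMdeg_empty, tsub_zero,
        MvPolynomial.monomial_neg_one_pow]
      exact Ideal.mul_mem_left _ _ (hM i)
    · exact Ideal.zero_mem _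

lemma taylor_isHomogeneousMat : (taylor M l).IsHomogeneousMat l := by
  intro τ σ
  rw [taylor_mat_apply]
  refine IsHomogeneousEntry.sum _ _ fun i _ => ?_
  split_ifs with h
  · rw [h.2]
    exact .monomial _ _ (tsub_add_cancel_of_le (faceMdeg_mono l (subset_insert _ _)))
  · exact .zero

/-- Each multigraded strand of the Taylor resolution is contracted by coning from the first
generator that divides the multidegree of the strand. -/
lemma exists_taylor_mulVec_eq (f : Finset (Fin q) → MvPolynomial ι k) {j : ℕ}
    (hj : ∀ σ, f σ ≠ 0 → σ.card = j) (hf : (taylor M l).mat.mulVec f = 0)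
    (hm : ∀ σ m, MvPolynomial.coeff m (MvPolynomial.monomial (faceMdeg l σ) 1 * f σ) ≠ 0 →
      ∃ i, l i ≤ m) :
    ∃ g : Finset (Fin q) → MvPolynomial ι k, (∀ σ, g σ ≠ 0 → σ.card = j + 1) ∧
      (taylor M l).mat.mulVec g = f := by
  classical
  -- `c m` is the simplicial chain formed by the multidegree-`m` part of `f`; it lives on faces
  -- whose multidegree divides `m`.
  set c : (ι →₀ ℕ) → Finset (Fin q) → k := fun m σ =>
    MvPolynomial.coeff m (MvPolynomial.monomial (faceMdeg l σ) 1 * f σ) with hc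
  have hc0 : ∀ m σ, c m σ ≠ 0 → faceMdeg l σ ≤ m := by
    intro m σ h
    by_contra hle
    exact h (by rw [hc]; simp only; rw [MvPolynomial.coeff_monomial_mul', if_neg hle])
  have hbd : ∀ (h : Finset (Fin q) → MvPolynomial ι k) (m : ι →₀ ℕ) τ,
      MvPolynomial.coeff m (simplexBoundary h τ) =
        simplexBoundary (fun σ => MvPolynomial.coeff m (h σ)) τ := by
    intro h m τ
    simp only [simplexBoundary, MvPolynomial.coeff_sum]
    refine sum_congr rfl fun i _ => ?_
    split_ifs
    · exact MvPolynomial.coeff_zero m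
    · exact MvPolynomial.coeff_neg_one_pow_mul ..
  -- In each strand `m` this is the cone whose apex is the least `i` with `l i ≤ m`. Coning with
  -- such an apex keeps the multidegree below `m`, so the truncated subtraction is a true quotient.
  let g : Finset (Fin q) → MvPolynomial ι k := fun σ => ∑ i ∈ σ,
    ∑ m ∈ (MvPolynomial.monomial (faceMdeg l (σ.erase i)) 1 * f (σ.erase i)).support,
      if IsLeast {i | l i ≤ m} i then MvPolynomial.monomial (m - faceMdeg l σ) (c m (σ.erase i))
      else 0
  have hg : ∀ σ m, MvPolynomial.coeff m (MvPolynomial.monomial (faceMdeg l σ) 1 * g σ) =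
      ∑ i ∈ σ, if IsLeast {i | l i ≤ m} i then c m (σ.erase i) else 0 := by
    intro σ m
    simp only [g, mul_sum, MvPolynomial.coeff_sum]
    refine sum_congr rfl fun i hi => ?_
    have : ∀ m' ∈ (MvPolynomial.monomial (faceMdeg l (σ.erase i)) 1 * f (σ.erase i)).support,
        MvPolynomial.coeff m (MvPolynomial.monomial (faceMdeg l σ) 1 *
          if IsLeast {i | l i ≤ m'} i then
            MvPolynomial.monomial (m' - faceMdeg l σ) (c m' (σ.erase i)) else 0) =
        if m' = m then (if IsLeast {i | l i ≤ m} i then c m (σ.erase i) else 0) else 0 := by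
      intro m' hm'
      by_cases h1 : IsLeast {i | l i ≤ m'} i
      · have h2 : faceMdeg l σ ≤ m' := by
          rw [← insert_erase hi, faceMdeg_insert]
          exact sup_le h1.1 (hc0 _ _ (MvPolynomial.mem_support_iff.1 hm'))
        rw [if_pos h1, MvPolynomial.monomial_mul, one_mul, add_tsub_cancel_of_le h2,
          MvPolynomial.coeff_monomial]
        split_ifs with h3 h4
        · rw [h3]
        · exact absurd (h3 ▸ h1) h4
        · rfl
      · rw [if_neg h1, mul_zero, MvPolynomial.coeff_zero]
        split_ifs with h3 h4
        · exact absurd (h3 ▸ h4) h1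
        · rfl
        · rfl
    rw [sum_congr rfl this, sum_ite_eq']
    split_ifs with h1 h2 h2
    · rfl
    · rfl
    · exact (MvPolynomial.notMem_support_iff.1 h1).symm
    · rfl
  refine ⟨g, fun σ hσ => ?_, funext fun τ => ?_⟩
  · contrapose! hσ
    refine sum_eq_zero fun i hi => ?_
    have : f (σ.erase i) = 0 := by
      by_contra h
      exact hσ (by rw [← card_erase_add_one hi, hj _ h])
    simp [this]
  · refine mul_left_cancel₀ (MvPolynomial.monomial_eq_zero.not.2 (one_ne_zero (α := k)) :
      MvPolynomial.monomial (faceMdeg l τ) (1 : k) ≠ 0) ?_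
    rw [taylor_mulVec]
    ext m
    rw [hbd]
    simp only [hg]
    by_cases hex : ∃ i, l i ≤ m
    · obtain ⟨i₀, hi₀⟩ : ∃ i₀, IsLeast {i | l i ≤ m} i₀ :=
        ⟨_, (Set.toFinite {i | l i ≤ m}).isWF.min_mem hex,
          fun i hi => (Set.toFinite {i | l i ≤ m}).isWF.min_le hex hi⟩
      have h1 : (fun σ : Finset (Fin q) => ∑ i ∈ σ,
          if IsLeast {i | l i ≤ m} i then c m (σ.erase i) else 0) = simplexCone i₀ (c m) := by
        funext σ
        have : ∀ i, IsLeast {i | l i ≤ m} i ↔ i = i₀ := fun i =>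
          ⟨fun h => h.unique hi₀, fun h => h ▸ hi₀⟩
        simp only [this, sum_ite_eq', simplexCone]
      have h2 : simplexBoundary (c m) = 0 := by
        funext σ
        rw [← hbd, ← taylor_mulVec M l, hf]
        simp
      have h3 := simplexBoundary_cone_add i₀ (c m) (fun σ hσ i hi =>
        hi₀.2 ((le_faceMdeg l hi).trans (hc0 m σ hσ))) τ
      rw [h2] at h3
      rw [h1, ← add_zero (simplexBoundary _ _)]
      simpa [simplexCone] using h3
    -- Without a generator dividing `m` there is no apex, but `hm` makes the strand zero.
    · have h1 : ∀ i, ¬ IsLeast {i | l i ≤ m} i := fun i h => hex ⟨i, h.1⟩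
      have h2 : MvPolynomial.coeff m (MvPolynomial.monomial (faceMdeg l τ) 1 * f τ) = 0 := by
        by_contra h
        exact hex (hm τ m h)
      simp [h1, h2, simplexBoundary]

lemma taylor_exists_d_eq {j : ℕ} (x : (taylor M l).X j)
    (hx : (taylor M l).mat.mulVec ((taylor M l).ext0 x) = 0)
    (hm : ∀ σ m, MvPolynomial.coeff m (MvPolynomial.monomial (faceMdeg l σ) 1 *
      (taylor M l).ext0 x σ) ≠ 0 → ∃ i, l i ≤ m) :
    ∃ y, (taylor M l).d j y = x := by
  obtain ⟨g, hg, hgf⟩ := exists_taylor_mulVec_eq M l ((taylor M l).ext0 x) (j := j)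
    (fun σ hσ => (not_imp_comm.1 ((taylor M l).ext0_of_not x) hσ).2) hx hm
  refine ⟨fun σ => g σ.1, (taylor M l).ext0_injective ?_⟩
  rw [ext0_d, ext0_eq_of_support, hgf]
  intro σ hσ
  by_contra h
  exact hσ ⟨mem_univ _, hg σ h⟩

lemma taylor_exact_succ (hM : ∀ i, MvPolynomial.monomial (l i) 1 ∈ M) (j : ℕ) :
    Function.Exact ((taylor M l).d (j + 1)) ((taylor M l).d j) := by
  intro x
  constructor
  · intro hx
    refine taylor_exists_d_eq M l x (by rw [← ext0_d, hx, ext0_zero]) fun σ m h => ?_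
    rw [MvPolynomial.coeff_monomial_mul'] at h
    split_ifs at h with hle
    -- In positive homological degree any vertex of $\sigma$ supplies a generator dividing `m`.
    · obtain ⟨i, hi⟩ : σ.Nonempty := by
        by_contra hne
        rw [not_nonempty_iff_eq_empty] at hne
        refine h ?_
        rw [ext0_of_not _ _ (by simp [hne])]
        simp
      exact ⟨i, (le_faceMdeg l hi).trans hle⟩
    · exact absurd rfl h
  · rintro ⟨y, rfl⟩
    exact (taylor_isComplex M l hM).d_d j y

lemma taylor_augmentation (x : (taylor M l).X 0) :
    (taylor M l).augmentation x = Ideal.Quotient.mk M ((taylor M l).ext0 x ∅) := by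
  rw [augmentation_apply]
  change ∑ π, _ • (if π = ∅ then (1 : MvPolynomial ι k ⧸ M) else 0) = _
  simp only [smul_ite, smul_zero, sum_ite_eq', mem_univ, if_true]
  exact Ideal.Quotient.smul_one_eq_mk M _

lemma taylor_augmentation_surjective : Function.Surjective (taylor M l).augmentation := by
  intro z
  obtain ⟨p, rfl⟩ := Ideal.Quotient.mk_surjective z
  refine ⟨fun _ => p, ?_⟩
  rw [taylor_augmentation]
  congr 1
  exact dif_pos ⟨mem_univ _, card_empty⟩

/-- In degree $0$ the only face is empty, and the generator dividing each monomial comes from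
membership in the monomial ideal $M$. -/
lemma taylor_exact_zero
    (hM : Ideal.span ((fun a => MvPolynomial.monomial a (1 : k)) '' Set.range l) = M) :
    Function.Exact ((taylor M l).d 0) (taylor M l).augmentation := by
  have hM' : ∀ i, MvPolynomial.monomial (l i) 1 ∈ M := fun i =>
    hM ▸ Ideal.subset_span ⟨l i, ⟨i, rfl⟩, rfl⟩
  intro x
  constructor
  · intro hx
    rw [taylor_augmentation, Ideal.Quotient.eq_zero_iff_mem, ← hM,
      MvPolynomial.mem_ideal_span_monomial_image] at hx
    refine taylor_exists_d_eq M l x ?_ fun σ m h => ?_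
    · funext τ
      rw [Matrix.mulVec, dotProduct]
      refine sum_eq_zero fun σ _ => ?_
      by_cases hσ : σ.card = 0
      · rw [mat_eq_zero_of_card _ (by omega), zero_mul]
      · rw [ext0_of_not _ _ fun h => hσ h.2, mul_zero]
    · by_cases hσ : σ = ∅
      · subst hσ
        rw [faceMdeg_empty, ← MvPolynomial.C_apply, MvPolynomial.C_1, one_mul] at h
        obtain ⟨_, ⟨i, rfl⟩, hi⟩ := hx m (MvPolynomial.mem_support_iff.2 h)
        exact ⟨i, hi⟩
      · rw [ext0_of_not _ _ (by simp [hσ])] at h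
        simp at h
  · rintro ⟨y, rfl⟩
    exact (taylor_isComplex M l hM').augmentation_d y

lemma taylor_homogeneous_aug (σ : Finset (Fin q)) : ∃ c : k, (taylor M l).aug σ =
    Ideal.Quotient.mk M (MvPolynomial.monomial (faceMdeg l σ) c) := by
  by_cases h : σ = ∅
  · exact ⟨1, by rw [h, faceMdeg_empty, ← MvPolynomial.C_apply, MvPolynomial.C_1, map_one]; rfl⟩
  · refine ⟨0, ?_⟩
    rw [map_zero, map_zero]
    exact if_neg h

variable {l}

/-- With equal multidegrees the monomial quotient is $1$ and the entry is $\pm1$. -/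
lemma taylor_canCancel {σ τ : Finset (Fin q)} (h : IsFacetOf τ σ)
    (hl : faceMdeg l σ = faceMdeg l τ) : (taylor M l).CanCancel σ τ := by
  obtain ⟨i, hi, rfl⟩ := h
  refine ⟨mem_univ _, mem_univ _, (card_erase_add_one hi).symm, ?_⟩
  rw [taylor_mat_apply, sum_eq_single i, if_pos ⟨notMem_erase _ _, (insert_erase hi).symm⟩,
    insert_erase hi, hl, tsub_self, ← MvPolynomial.C_apply]
  · exact ((isUnit_one.neg).pow _).map _
  · intro i' _ hne
    rw [if_neg]
    rintro ⟨h1, h2⟩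
    rw [h2] at hi
    rcases mem_insert.1 hi with h3 | h3
    · exact hne h3.symm
    · simp at h3
  · simp

end FramedComplex

/-! ### Combinatorics of 2-semidominant sets -/

section combinatorics

variable {ι : Type*} {q : ℕ} {l : Fin q → ι →₀ ℕ}

lemma faceMdeg_apply (l : Fin q → ι →₀ ℕ) (σ : Finset (Fin q)) (x : ι) :
    faceMdeg l σ x = σ.sup fun i => l i x :=
  Finset.apply_sup_eq_sup_comp (fun m : ι →₀ ℕ => m x) (fun _ _ => rfl) rfl

/-- The multidegree of a face determines its dominant vertices. -/
lemma mem_of_faceMdeg_eq (hinj : Function.Injective l) {σ τ : Finset (Fin q)}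
    (h : faceMdeg l σ = faceMdeg l τ) {i : Fin q}
    (hi : IsDominantMonomial (Set.range l) (l i)) (hσ : i ∈ σ) : i ∈ τ := by
  obtain ⟨x, n, hn, hle, hlt⟩ := hi
  by_contra hτ
  -- Every generator other than `l i` has exponent below `n` at `x`; positivity of `n` covers the
  -- empty face.
  have h1 : faceMdeg l τ x < n := by
    rw [faceMdeg_apply, Finset.sup_lt_iff (by simpa using hn)]
    intro i' hi'
    exact not_le.1 (hlt _ ⟨i', rfl⟩ fun h' => hτ (hinj h' ▸ hi'))
  rw [← h] at h1
  exact absurd (hle.trans (le_faceMdeg l hσ x)) (not_le.2 h1)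

/-- Faces that differ only in two vertices and have consecutive sizes are facets of each other. -/
lemma isFacetOf_of_card_eq {N σ τ : Finset (Fin q)} (hN : N.card ≤ 2)
    (h : ∀ i, i ∉ N → (i ∈ σ ↔ i ∈ τ)) (hc : σ.card = τ.card + 1) : IsFacetOf τ σ := by
  have h1 := card_sdiff_add_card_inter σ τ
  have h2 := card_sdiff_add_card_inter τ σ
  rw [inter_comm τ σ] at h2
  have h3 : (σ \ τ).card + (τ \ σ).card ≤ N.card := by
    rw [← card_union_of_disjoint disjoint_sdiff_sdiff]
    refine card_le_card fun i hi => ?_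
    by_contra hiN
    have := h i hiN
    simp only [mem_union, mem_sdiff] at hi
    tauto
  -- The two differences have sizes with sum at most $2$ and difference $1$, hence sizes $1$ and
  -- $0$.
  have h4 : (τ \ σ).card = 0 := by omega
  have h5 : (σ \ τ).card = 1 := by omega
  have hsub : τ ⊆ σ := sdiff_eq_empty_iff_subset.1 (card_eq_zero.1 h4)
  obtain ⟨i, hi⟩ := card_eq_one.1 h5
  have hi' : i ∈ σ \ τ := hi ▸ mem_singleton_self i
  refine ⟨i, (mem_sdiff.1 hi').1, ?_⟩
  rw [← sdiff_singleton_eq_erase, ← hi, Finset.sdiff_sdiff_eq_self hsub]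

lemma IsFacetOf.subset {σ τ : Finset (Fin q)} (h : IsFacetOf τ σ) : τ ⊆ σ := by
  obtain ⟨i, -, rfl⟩ := h
  exact erase_subset _ _

lemma IsFacetOf.card_eq {σ τ : Finset (Fin q)} (h : IsFacetOf τ σ) : σ.card = τ.card + 1 := by
  obtain ⟨i, hi, rfl⟩ := h
  exact (card_erase_add_one hi).symm

/-- Two distinct faces of the same size cannot share two distinct facets. -/
lemma eq_of_isFacetOf {σ σ' τ τ' : Finset (Fin q)} (h : IsFacetOf τ σ) (h' : IsFacetOf τ' σ)
    (g : IsFacetOf τ σ') (g' : IsFacetOf τ' σ') (hne : τ ≠ τ') : σ = σ' := by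
  have hc : τ.card < (τ ∪ τ').card := by
    refine card_lt_card ⟨subset_union_left, fun hsub => hne ?_⟩
    have h1 : τ' ⊆ τ := subset_union_right.trans hsub
    have h2 := h.card_eq
    have h3 := h'.card_eq
    exact (eq_of_subset_of_card_le h1 (by omega)).symm
  -- A face with two distinct facets is their union.
  have key : ∀ ρ, IsFacetOf τ ρ → IsFacetOf τ' ρ → τ ∪ τ' = ρ := fun ρ hρ hρ' =>
    eq_of_subset_of_card_le (union_subset hρ.subset hρ'.subset) (by rw [hρ.card_eq]; omega)
  rw [← key σ h h', key σ' g g']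

/-- In a 2-semidominant set, faces of equal multidegree and consecutive sizes form a
face-facet pair. -/
lemma IsSemidominantSet.isFacetOf (hM : IsSemidominantSet 2 (Set.range l))
    (hinj : Function.Injective l) {σ τ : Finset (Fin q)} (h : faceMdeg l σ = faceMdeg l τ)
    (hc : σ.card = τ.card + 1) : IsFacetOf τ σ := by
  classical
  set N : Finset (Fin q) := {i | ¬ IsDominantMonomial (Set.range l) (l i)} with hNdef
  have hN : (l '' N).encard = 2 := by
    rw [← Nat.cast_ofNat, ← hM]
    congr 1
    ext m
    simp only [hNdef, coe_filter, mem_univ, true_and, Set.mem_image, Set.mem_ofPred_eq,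
      Set.mem_range]
    constructor
    · rintro ⟨i, hi, rfl⟩
      exact ⟨⟨i, rfl⟩, hi⟩
    · rintro ⟨⟨i, rfl⟩, hi⟩
      exact ⟨i, hi, rfl⟩
  rw [hinj.encard_image, Set.encard_coe_eq_coe_finsetCard] at hN
  refine isFacetOf_of_card_eq (N := N) (by exact_mod_cast hN.le) (fun i hi => ?_) hc
  have hd : IsDominantMonomial (Set.range l) (l i) := by simpa [hNdef] using hi
  exact ⟨mem_of_faceMdeg_eq hinj h hd, mem_of_faceMdeg_eq hinj h.symm hd⟩

end combinatorics

/-! ### The main theorem -/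

theorem theorem6p5 {ι k : Type*} [Finite ι] [Field k] {q : ℕ}
    (M : Ideal (MvPolynomial ι k)) (l : Fin q → ι →₀ ℕ)
    (hl : IsMinimalMonomialGenerators l M)
    (hM : IsSemidominantSet 2 (Set.range l))
    (A : Finset (Finset (Fin q) × Finset (Fin q)))
    (hA : Maximal (IsFaceFacetFamily l) A)
    (L : List (Finset (Fin q) × Finset (Fin q)))
    (hL : L.Nodup) (hLA : ∀ p, p ∈ L ↔ p ∈ A) :
    ∃ F : FramedComplex q M,
      FramedComplex.CancelSeq (FramedComplex.taylor M l) L F ∧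
      F.IsGradedFreeResolution l ∧
      F.IsMinimal ∧
      (FramedComplex.taylor M l).IsDirectSumWith F l A := by
  obtain ⟨hinj, hspan, -⟩ := hl
  have hmem : ∀ i, MvPolynomial.monomial (l i) 1 ∈ M := fun i =>
    hspan ▸ Ideal.subset_span ⟨l i, ⟨i, rfl⟩, rfl⟩
  obtain ⟨hdisj, hfacet, hmdeg⟩ := hA.prop
  obtain ⟨F, hseq, hsum, hhom, haug, hbasis⟩ := FramedComplex.exists_cancelSeq l L
    (FramedComplex.taylor M l) (FramedComplex.taylor_isComplex M l hmem)
    (FramedComplex.taylor_isHomogeneousMat M l)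
    (fun p hp => FramedComplex.taylor_canCancel M (hfacet p ((hLA p).1 hp))
      (hmdeg p ((hLA p).1 hp)))
    (hL.pairwise_of_forall_ne fun p hp p' hp' hne =>
      hdisj p ((hLA p).1 hp) p' ((hLA p').1 hp') hne)
    (hL.pairwise_of_forall_ne fun p hp p' hp' hne hdeg hcard => by
      rw [hLA] at hp hp'
      obtain ⟨d1, -, -, d4⟩ := hdisj p hp p' hp' hne
      have f := hfacet p hp
      have f' := hfacet p' hp'
      -- All four faces share one multidegree, so 2-semidominance makes $\tau'$ a facet of $\sigma$
      -- and $\tau$ a facet of $\sigma'$.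
      refine d1 (eq_of_isFacetOf f ?_ ?_ f' d4)
      · exact hM.isFacetOf hinj (hdeg.trans (hmdeg p' hp')) (hcard.trans f'.card_eq)
      · exact hM.isFacetOf hinj (hdeg.symm.trans (hmdeg p hp)) (hcard.symm.trans f.card_eq))
  have hLA' : L.toFinset = A := by
    ext p
    rw [List.mem_toFinset, hLA]
  rw [hLA'] at hsum
  refine ⟨F, hseq, ⟨?_, ?_, fun j => ?_, hhom, fun σ => ?_⟩, ?_, hsum⟩
  · exact hsum.surjective_augmentation (FramedComplex.taylor_augmentation_surjective M l)
  · exact hsum.exact_zero (FramedComplex.taylor_exact_zero M l hspan)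
  · exact hsum.exact_succ j (FramedComplex.taylor_exact_succ M l hmem j)
  · rcases haug σ with h | h
    · rw [h]
      exact FramedComplex.taylor_homogeneous_aug M l σ
    · exact ⟨0, by rw [h, map_zero, map_zero]⟩
  · refine FramedComplex.isMinimal_of_faceMdeg_ne hhom fun τ hτ σ hσ hc hdeg => ?_
    -- A surviving pair of equal multidegree would enlarge $A$; maximality puts it in $A$, yet
    -- members of $A$ were removed from the basis.
    have hfam : IsFaceFacetFamily l (insert (σ, τ) A) := by
      have hσA : ∀ p ∈ A, σ ≠ p.1 ∧ σ ≠ p.2 := fun p hp => (hbasis σ hσ).2 p ((hLA p).2 hp)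
      have hτA : ∀ p ∈ A, τ ≠ p.1 ∧ τ ≠ p.2 := fun p hp => (hbasis τ hτ).2 p ((hLA p).2 hp)
      refine ⟨fun p hp p' hp' hne => ?_, fun p hp => ?_, fun p hp => ?_⟩
      · rcases mem_insert.1 hp with rfl | hp <;> rcases mem_insert.1 hp' with rfl | hp'
        · exact absurd rfl hne
        · exact ⟨(hσA p' hp').1, (hσA p' hp').2, (hτA p' hp').1, (hτA p' hp').2⟩
        · exact ⟨(hσA p hp).1.symm, (hτA p hp).1.symm, (hσA p hp).2.symm, (hτA p hp).2.symm⟩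
        · exact hdisj p hp p' hp' hne
      · rcases mem_insert.1 hp with rfl | hp
        · exact hM.isFacetOf hinj hdeg.symm hc
        · exact hfacet p hp
      · rcases mem_insert.1 hp with rfl | hp
        · exact hdeg.symm
        · exact hmdeg p hp
    have hin : (σ, τ) ∈ A := hA.2 hfam (subset_insert _ _) (mem_insert_self _ _)
    exact ((hbasis σ hσ).2 _ ((hLA _).2 hin)).1 rfl
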